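/- **Theorem (pointwise global Lipschitz continuity of the prior-to-posterior map).** *Conventions.* All likelihood, observation and transition models are nonnegative real-valued functions, and the data $y$ are fixed. For probability measures $\mu,\mu'$ on a measurable space, $d_{TV}(\mu,\mu')=\sup_A|\mu(A)-\mu'(A)|$ (supremum over measurable sets), and $d_H(\mu,\mu')=\Big(\tfrac12\int\big(\sqrt{d\mu/d\nu}-\sqrt{d\mu'/d\nu}\big)^2d\nu\Big)^{1/2}$ for any $\sigma$-finite $\nu$ dominating both. On a metric space $(\mathcal Z,d)$ let $W_1(\mu,\mu')=\inf_\gamma\int d(z,z')\,\gamma(dz,dz')$ over couplings $\gamma$ of $\mu,\mu'$, and let $\mathcal P_1(\mathcal Z)$ be the set of probability measures $\mu$ with $\int d(z_0,z)\,\mu(dz)<\infty$ for some $z_0$. For $f:\mathcal Z\to[0,\infty)$ let $\|f\|_{\mathrm{Lip}}=\sup_{z\ne z'}|f(z)-f(z')|/d(z,z')$. In state and parameter-state estimation, $dx$ and $dw$ denote fixed $\sigma$-finite reference measures on $\mathcal X$ and $\mathcal W$ (for example Lebesgue measure on Borel subsets of Euclidean spaces). For an unnormalized posterior $\tilde F\mu$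 (given below in each problem) put $Z(\mu)=\tilde F\mu(\bar{\mathcal X})$ (the evidence) and $F\mu=\tilde F\mu/Z(\mu)$ (the posterior), where $\bar{\mathcal X}$ is $\mathcal X$ or $\mathcal X\times\mathcal W$ with metric $d_{\bar{\mathcal X}}$, and let $D=\sup_{\bar x,\bar x'}d_{\bar{\mathcal X}}(\bar x,\bar x')$. *Claim.* In each case below, $F$ maps the set $\mathcal Q$ of priors into the probability measures and is pointwise globally Lipschitz continuous on $\mathcal Q$: for every $\mu\in\mathcal Q$ there is a constant $K(\mu)>0$, not depending on $\mu'$, with $$d(F\mu,F\mu')\le K(\mu)\,d(\mu,\mu')\qquad\text{for all }\mu'\in\mathcal Q.$$ Moreover, the inequality holds with the constant $K(\mu)\ge0$ given explicitly. Here $\mathcal Q=\bar{\mathcal P}$, the set of admissible priors, for $d=d_{TV}$ and $d=d_H$, and $\mathcal Q=\bar{\mathcal P}\cap\mathcal P_1(\bar{\mathcal X})$ for $d=W_1$. 1. **Inverse problems.** $\mathcal X$ is a Polish metric space with its Borel $\sigma$-algebra, $h(y,\cdot)$ is measurable, $\tilde F\mu(dx)=h(y,x)\,\mu(dx)$, and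 $\bar{\mathcal P}$ is the set of probability measures $\mu$ on $\mathcal X$ with $0<\int h(y,x)\,\mu(dx)<\infty$. Assume $C_h:=\sup_xh(y,x)<\infty$. Then one may take $K(\mu)=C_h/Z(\mu)$ for $d_{TV}$ and $K(\mu)=2\sqrt{C_h/Z(\mu)}$ for $d_H$. If in addition $L:=\|h(y,\cdot)\|_{\mathrm{Lip}}<\infty$ and $D<\infty$, one may take $K(\mu)=(2DL+C_h)/Z(\mu)$ for $W_1$. 2. **State estimation.** $\mathcal X$ is a Polish metric space with its Borel $\sigma$-algebra, $h(y,\cdot)$ and $(x,x')\mapsto T(x,x')$ are measurable ($x'$ is the previous and $x$ the current state), $\tilde F\mu(dx)=h(y,x)\big(\int T(x,x')\,\mu(dx')\big)dx$, and $\bar{\mathcal P}$ is the set of probability measures $\mu$ on $\mathcal X$ with $\int T(x,x')\mu(dx')<\infty$ for all $x$ and $0<\int h(y,x)\int T(x,x')\mu(dx')\,dx<\infty$. If $C_{Th}:=\sup_{x'}\int h(y,x)T(x,x')\,dx<\infty$, one may take $K(\mu)=C_{Th}/Z(\mu)$ for $d_{TV}$ and $K(\mu)=2\sqrt{C_{Th}/Z(\mu)}$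 for $d_H$. If $\|T(x,\cdot)\|_{\mathrm{Lip}}<\infty$ for all $x$, $C^*_{Th}:=\int h(y,x)\|T(x,\cdot)\|_{\mathrm{Lip}}\,dx<\infty$ and $D<\infty$ (and without assuming $C_{Th}<\infty$), one may take $K(\mu)=2DC^*_{Th}/Z(\mu)$ for $W_1$. 3. **Parameter-state estimation.** $\mathcal X\times\mathcal W$ carries a metric making it a Polish metric space whose Borel $\sigma$-algebra is the product $\sigma$-algebra; $\lambda=dx\otimes dw$; $h(y,\cdot,\cdot)$ and $(x,x',w)\mapsto T(x,x',w)$ are measurable. For $\mu\ll\lambda$ with density $\pi$, $\tilde F\mu(dx,dw)=h(y,x,w)\big(\int T(x,x',w)\pi(x',w)\,dx'\big)dx\,dw$, and $\bar{\mathcal P}$ is the set of probability measures $\mu\ll\lambda$ having a version $\pi$ of the density with $\int T(x,x',w)\pi(x',w)dx'<\infty$ for all $x,w$, and $0<\tilde F\mu(\mathcal X\times\mathcal W)<\infty$. Assume $\tilde C_{Th}:=\sup_{x',w}\int h(y,x,w)T(x,x',w)\,dx<\infty$. Then one may take $K(\mu)=\tilde C_{Th}/Z(\mu)$ for $d_{TV}$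 and $K(\mu)=2\sqrt{\tilde C_{Th}/Z(\mu)}$ for $d_H$. If in addition, with $\tilde f_{\mathrm{Lip}}(x)$ the best Lipschitz constant of $(x',w)\mapsto h(y,x,w)T(x,x',w)$ on $\mathcal X\times\mathcal W$, one has $\tilde f_{\mathrm{Lip}}(x)<\infty$ for all $x$, $\tilde C^*_{Th}:=\int\tilde f_{\mathrm{Lip}}(x)\,dx<\infty$, $d_{\mathcal X\times\mathcal W}((x,w),(x,w'))\le d_{\mathcal X\times\mathcal W}((x_1,w),(x_2,w'))$ for all $x,x_1,x_2\in\mathcal X$ and $w,w'\in\mathcal W$, and $D<\infty$, one may take $K(\mu)=(2D\tilde C^*_{Th}+\tilde C_{Th})/Z(\mu)$ for $W_1$. -/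

import Mathlib

open MeasureTheory Set
open scoped NNReal ENNReal

noncomputable section

namespace BayesLip

/-! ### Pointwise globally Lipschitz maps -/

section Lipschitz

variable {Z Z' : Type*}

/-- `c ≥ 0` is a pointwise Lipschitz constant at `z` of the map `f`, regarded on the domain `P`,
with respect to the distance `d` on the domain and `d'` on the codomain. -/
def IsPointwiseLipschitzConstant (d : Z → Z → ℝ) (d' : Z' → Z' → ℝ) (P : Set Z) (f : Z → Z')
    (z : Z) (c : ℝ) : Prop :=
  0 ≤ c ∧ ∀ z' ∈ P, d' (f z) (f z') ≤ c * d z z'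

/-- The map `f`, regarded on the domain `P`, is pointwise globally Lipschitz continuous: at every
`z ∈ P` there is a positive constant, depending on `z` only, that works for all `z' ∈ P`. -/
def PointwiseGloballyLipschitzOn (d : Z → Z → ℝ) (d' : Z' → Z' → ℝ) (P : Set Z) (f : Z → Z') :
    Prop :=
  ∀ z ∈ P, ∃ c : ℝ, 0 < c ∧ ∀ z' ∈ P, d' (f z) (f z') ≤ c * d z z'

/-- The best Lipschitz constant `sup_{z ≠ z'} |f z - f z'| / d(z, z')`, as an extended number. -/
def bestLip [MetricSpace Z] (f : Z → ℝ≥0) : ℝ≥0∞ :=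
  ⨆ (z : Z) (z' : Z) (_ : z ≠ z'), edist (f z) (f z') / edist z z'

end Lipschitz

/-! ### Distances between probability measures -/

section Distances

variable {Z : Type*} [MeasurableSpace Z]

/-- Total variation distance `sup_A |μ(A) - μ'(A)|` over measurable sets `A`. -/
def tvDist (μ μ' : Measure Z) : ℝ :=
  ⨆ A : {A : Set Z // MeasurableSet A}, |μ.real A.1 - μ'.real A.1|

/-- The Hellinger distance computed with the reference measure `ν`. -/
def hellingerDistWrt (ν μ μ' : Measure Z) : ℝ :=
  √((1 / 2) * ∫ z, (√(μ.rnDeriv ν z).toReal - √(μ'.rnDeriv ν z).toReal) ^ 2 ∂ν)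

/-- Hellinger distance, computed with the dominating measure `μ + μ'`; any other σ-finite
dominating measure gives the same value, see `hellingerDistWrt_eq`. -/
def hellingerDist (μ μ' : Measure Z) : ℝ :=
  hellingerDistWrt (μ + μ') μ μ'

theorem hellingerDistWrt_eq (ν μ μ' : Measure Z) [SigmaFinite ν] [IsProbabilityMeasure μ]
    [IsProbabilityMeasure μ'] (h : μ ≪ ν) (h' : μ' ≪ ν) :
    hellingerDistWrt ν μ μ' = hellingerDist μ μ' := by
  have hτ : μ + μ' ≪ ν := Measure.AbsolutelyContinuous.add_left_iff.2 ⟨h, h'⟩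
  have h1 : μ ≪ μ + μ' := Measure.le_add_right le_rfl |>.absolutelyContinuous
  have h2 : μ' ≪ μ + μ' := Measure.le_add_left le_rfl |>.absolutelyContinuous
  unfold hellingerDist hellingerDistWrt
  rw [← integral_rnDeriv_smul hτ]
  congr 2
  apply integral_congr_ae
  filter_upwards [Measure.rnDeriv_mul_rnDeriv (κ := ν) h1,
    Measure.rnDeriv_mul_rnDeriv (κ := ν) h2] with z hz hz'
  rw [← hz, ← hz']
  simp only [Pi.mul_apply, ENNReal.toReal_mul, smul_eq_mul]
  rw [Real.sqrt_mul ENNReal.toReal_nonneg, Real.sqrt_mul ENNReal.toReal_nonneg, ← sub_mul, mul_pow,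
    Real.sq_sqrt ENNReal.toReal_nonneg, mul_comm]

/-- The couplings of `μ` and `μ'`. -/
def couplings (μ μ' : Measure Z) : Set (Measure (Z × Z)) :=
  {γ | γ.map Prod.fst = μ ∧ γ.map Prod.snd = μ'}

/-- The 1-Wasserstein distance `inf_γ E_γ[d(z, z')]` over couplings `γ`.  It is finite, hence not
affected by `toReal`, for `μ` and `μ'` in the Wasserstein space `wassersteinSpace1`. -/
def wasserstein1 [MetricSpace Z] (μ μ' : Measure Z) : ℝ :=
  (⨅ γ ∈ couplings μ μ', ∫⁻ p, edist p.1 p.2 ∂γ).toReal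

/-- The Wasserstein space of order 1: probability measures with finite first moment. -/
def wassersteinSpace1 (Z : Type*) [MeasurableSpace Z] [MetricSpace Z] : Set (Measure Z) :=
  {μ | IsProbabilityMeasure μ ∧ ∃ z₀ : Z, ∫⁻ z, edist z₀ z ∂μ < ∞}

end Distances

/-! ### Prior-to-posterior maps

Each of the three problems has an unnormalized map `unnorm : Measure Z → Measure Z`.  The evidence
of a prior is the total mass of its image, and the posterior is the normalized image. -/

section Posterior

variable {Z : Type*} [MeasurableSpace Z]

/-- Evidence of the prior `μ`. -/
def evidence (unnorm : Measure Z → Measure Z) (μ : Measure Z) : ℝ≥0∞ := unnorm μ univ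

/-- Prior-to-posterior map. -/
def posterior (unnorm : Measure Z → Measure Z) (μ : Measure Z) : Measure Z :=
  (evidence unnorm μ)⁻¹ • unnorm μ

/-- The prior-to-posterior map of `unnorm` sends the set `P` of priors to probability measures, is
pointwise globally Lipschitz on `P` for the distance `d`, and `K μ` is a pointwise Lipschitz
constant at each `μ ∈ P`. -/
def PosteriorLipschitz (d : Measure Z → Measure Z → ℝ) (P : Set (Measure Z))
    (unnorm : Measure Z → Measure Z) (K : Measure Z → ℝ) : Prop :=
  (∀ μ ∈ P, IsProbabilityMeasure (posterior unnorm μ)) ∧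
  PointwiseGloballyLipschitzOn d d P (posterior unnorm) ∧
  ∀ μ ∈ P, IsPointwiseLipschitzConstant d d P (posterior unnorm) μ (K μ)

end Posterior

/-! ### Inverse problems: likelihood `h y x` -/

section InverseProblem

variable {X Y : Type*} [MeasurableSpace X]

/-- `h(y, x) μ(dx)`. -/
def ipUnnorm (h : Y → X → ℝ≥0) (y : Y) (μ : Measure X) : Measure X :=
  μ.withDensity fun x => h y x

/-- Admissible priors of an inverse problem. -/
def ipAdmissible (h : Y → X → ℝ≥0) (y : Y) : Set (Measure X) :=
  {μ | IsProbabilityMeasure μ ∧ 0 < ∫⁻ x, h y x ∂μ ∧ ∫⁻ x, h y x ∂μ < ∞}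

/-- `C_h(y) = sup_x h(y, x)`. -/
def ipC (h : Y → X → ℝ≥0) (y : Y) : ℝ≥0∞ := ⨆ x, (h y x : ℝ≥0∞)

end InverseProblem

/-! ### State estimation: observation model `h y x`, transition density `T x x'` from the
previous state `x'` to the current state `x` with respect to the reference measure `vX` -/

section StateEstimation

variable {X Y : Type*} [MeasurableSpace X]

/-- `h(y, x) (∫ T(x, x') μ(dx')) dx`. -/
def seUnnorm (vX : Measure X) (h : Y → X → ℝ≥0) (T : X → X → ℝ≥0) (y : Y) (μ : Measure X) :
    Measure X :=
  vX.withDensity fun x => h y x * ∫⁻ x', T x x' ∂μ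

/-- Admissible priors of a state estimation problem. -/
def seAdmissible (vX : Measure X) (h : Y → X → ℝ≥0) (T : X → X → ℝ≥0) (y : Y) :
    Set (Measure X) :=
  {μ | IsProbabilityMeasure μ ∧ (∀ x, ∫⁻ x', T x x' ∂μ < ∞) ∧
    0 < ∫⁻ x, h y x * ∫⁻ x', T x x' ∂μ ∂vX ∧ ∫⁻ x, h y x * ∫⁻ x', T x x' ∂μ ∂vX < ∞}

/-- `C_Th(y) = sup_{x'} ∫ h(y, x) T(x, x') dx`. -/
def seC (vX : Measure X) (h : Y → X → ℝ≥0) (T : X → X → ℝ≥0) (y : Y) : ℝ≥0∞ :=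
  ⨆ x', ∫⁻ x, h y x * T x x' ∂vX

/-- `C*_Th(y) = ∫ h(y, x) T_Lip(x) dx`, where `T_Lip(x)` is the best Lipschitz constant of
`T(x, ·)`. -/
def seCstar [MetricSpace X] (vX : Measure X) (h : Y → X → ℝ≥0) (T : X → X → ℝ≥0) (y : Y) :
    ℝ≥0∞ :=
  ∫⁻ x, h y x * bestLip (T x) ∂vX

end StateEstimation

/-! ### Parameter-state estimation: observation model `h y x w`, transition density `T x x' w`
from the previous state `x'` to the current state `x` under the parameter `w`, with respect to the
reference measure `vX`; the reference measure on the product is `vX.prod vW` -/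

section ParameterStateEstimation

variable {X W Y : Type*} [MeasurableSpace X] [MeasurableSpace W]

/-- `h(y, x, w) ∫ T(x, x', w) π(x', w) dx'` as a function of `p = (x, w)`. -/
def psDensity (vX : Measure X) (h : Y → X → W → ℝ≥0) (T : X → X → W → ℝ≥0) (y : Y)
    (π : X × W → ℝ≥0∞) (p : X × W) : ℝ≥0∞ :=
  h y p.1 p.2 * ∫⁻ x', T p.1 x' p.2 * π (x', p.2) ∂vX

/-- `h(y, x, w) (∫ T(x, x', w) π(x', w) dx') dx dw`, where `π` is the density of `μ`; the choice of
the version of the density does not affect this measure. -/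
def psUnnorm (vX : Measure X) (vW : Measure W) (h : Y → X → W → ℝ≥0) (T : X → X → W → ℝ≥0)
    (y : Y) (μ : Measure (X × W)) : Measure (X × W) :=
  (vX.prod vW).withDensity (psDensity vX h T y (μ.rnDeriv (vX.prod vW)))

/-- Admissible priors of a parameter-state estimation problem: probability measures with a density
`π` (in some version) that satisfies the stated conditions. -/
def psAdmissible (vX : Measure X) (vW : Measure W) (h : Y → X → W → ℝ≥0) (T : X → X → W → ℝ≥0)
    (y : Y) : Set (Measure (X × W)) :=
  {μ | IsProbabilityMeasure μ ∧ ∃ π : X × W → ℝ≥0∞, Measurable π ∧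
    μ = (vX.prod vW).withDensity π ∧
    (∀ x w, ∫⁻ x', T x x' w * π (x', w) ∂vX < ∞) ∧
    0 < ∫⁻ p, psDensity vX h T y π p ∂(vX.prod vW) ∧
    ∫⁻ p, psDensity vX h T y π p ∂(vX.prod vW) < ∞}

/-- `sup_{x', w} ∫ h(y, x, w) T(x, x', w) dx`. -/
def psC (vX : Measure X) (h : Y → X → W → ℝ≥0) (T : X → X → W → ℝ≥0) (y : Y) : ℝ≥0∞ :=
  ⨆ (x' : X) (w : W), ∫⁻ x, h y x w * T x x' w ∂vX

/-- The best Lipschitz constant of `(x', w) ↦ h(y, x, w) T(x, x', w)`. -/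
def psLip [MetricSpace (X × W)] (h : Y → X → W → ℝ≥0) (T : X → X → W → ℝ≥0) (y : Y) (x : X) :
    ℝ≥0∞ :=
  bestLip fun q : X × W => h y x q.2 * T x q.1 q.2

/-- `∫ psLip(x) dx`. -/
def psCstar [MetricSpace (X × W)] (vX : Measure X) (h : Y → X → W → ℝ≥0) (T : X → X → W → ℝ≥0)
    (y : Y) : ℝ≥0∞ :=
  ∫⁻ x, psLip h T y x ∂vX

end ParameterStateEstimation

end BayesLip

end

open BayesLip

/-! All three unnormalized maps have one form: `μ` is lifted to `μ ⊗ σ`, weighted by `q(z, s)` and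
pushed forward by `e`, with `z` a prior sample and `s` auxiliary. Inverse problems take a one-point
`s`, `q = h`, `e(z, s) = z`; state estimation takes `s` the new state, `q = hT`, `e(z, s) = s`;
parameter-state estimation sends `((x', w), x)` to `(x, w)`. Write `C` for a bound on the kernel
mass `∫ q(z, s) σ(ds)`. Each distance is then treated once for this form, and in each case only the
evidence `Z(μ)` enters the constant.

Total variation (`posterior_real_sub_le_tvDist`): with `p = Fμ'(A)`, the number `Z(μ)(Fμ(A) - p)` is
the `μ`-integral of a function of oscillation at most `C` whose `μ'`-integral is zero.

Wasserstein (`iInf_couplings_posterior_le`): a coupling `γ` of the priors puts both posteriors on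
the common space `γ ⊗ σ`, with two weights. The minimum of the weights is transported along `γ`; the
remainders have equal mass and cost at most `D` per unit mass.

Hellinger (`hellingerDist_posterior_le`): square roots of densities are vectors in `L²`, and
normalizing vectors is pointwise Lipschitz with factor `2/‖a‖`. Before normalization the squared
distance does not increase under the kernel beyond the factor `C`, because the affinity `∫ √(fg)`
satisfies a data processing inequality (`lintegral_geomMean_le_pushUnnorm`). -/

namespace BayesLip

/-! ### The common form of the unnormalized maps. -/

section PushUnnorm

variable {Z S : Type*} [MeasurableSpace Z] [MeasurableSpace S]

/-- The measure `A ↦ ∫∫ 1_A(e(z, s)) q(z, s) σ(ds) μ(dz)`. -/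
noncomputable def pushUnnorm (σ : Measure S) (q : Z × S → ℝ≥0) (e : Z × S → Z) (μ : Measure Z) :
    Measure Z :=
  ((μ.prod σ).withDensity fun p => q p).map e

variable {σ : Measure S} [SigmaFinite σ] {q : Z × S → ℝ≥0} {e : Z × S → Z}

theorem lintegral_pushUnnorm (hq : Measurable q) (he : Measurable e) (μ : Measure Z)
    [SFinite μ] {f : Z → ℝ≥0∞} (hf : Measurable f) :
    ∫⁻ z, f z ∂(pushUnnorm σ q e μ) = ∫⁻ z, ∫⁻ s, q (z, s) * f (e (z, s)) ∂σ ∂μ := by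
  rw [pushUnnorm, lintegral_map hf he,
    lintegral_withDensity_eq_lintegral_mul _ hq.coe_nnreal_ennreal (g := fun p => f (e p))
      (hf.comp he),
    lintegral_prod _ (by fun_prop)]
  rfl

theorem pushUnnorm_apply (hq : Measurable q) (he : Measurable e) (μ : Measure Z)
    [SFinite μ] {A : Set Z} (hA : MeasurableSet A) :
    pushUnnorm σ q e μ A = ∫⁻ z, ∫⁻ s, q (z, s) * A.indicator 1 (e (z, s)) ∂σ ∂μ := by
  rw [← lintegral_pushUnnorm hq he μ (measurable_one.indicator hA), lintegral_indicator_one hA]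

theorem pushUnnorm_univ (hq : Measurable q) (he : Measurable e) (μ : Measure Z) [SFinite μ] :
    pushUnnorm σ q e μ univ = ∫⁻ z, ∫⁻ s, q (z, s) ∂σ ∂μ := by
  simp [pushUnnorm_apply hq he μ MeasurableSet.univ]

end PushUnnorm

/-! ### Normalization and transfer between unnormalized maps. -/

section Posterior

variable {Z : Type*} [MeasurableSpace Z]

theorem isProbabilityMeasure_posterior {unnorm : Measure Z → Measure Z} {μ : Measure Z}
    (h0 : evidence unnorm μ ≠ 0) (h1 : evidence unnorm μ ≠ ∞) :
    IsProbabilityMeasure (posterior unnorm μ) :=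
  ⟨ENNReal.inv_mul_cancel h0 h1⟩

theorem PosteriorLipschitz.of_le {d : Measure Z → Measure Z → ℝ} (hd : ∀ μ μ', 0 ≤ d μ μ')
    {P : Set (Measure Z)} {unnorm : Measure Z → Measure Z} {K : Measure Z → ℝ}
    (hP : ∀ μ ∈ P, evidence unnorm μ ≠ 0 ∧ evidence unnorm μ ≠ ∞) (hK : ∀ μ ∈ P, 0 ≤ K μ)
    (h : ∀ μ ∈ P, ∀ μ' ∈ P,
      d (posterior unnorm μ) (posterior unnorm μ') ≤ K μ * d μ μ') :
    PosteriorLipschitz d P unnorm K :=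
  ⟨fun μ hμ => isProbabilityMeasure_posterior (hP μ hμ).1 (hP μ hμ).2,
    -- `K μ` may vanish, while pointwise global Lipschitz continuity asks for a strictly positive
    -- constant.
    fun μ hμ => ⟨K μ + 1, by linarith [hK μ hμ], fun μ' hμ' => (h μ hμ μ' hμ').trans
      (mul_le_mul_of_nonneg_right (by linarith) (hd μ μ'))⟩,
    fun μ hμ => ⟨hK μ hμ, h μ hμ⟩⟩

/-- `PosteriorLipschitz` depends on the unnormalized map only through its values on the priors. -/
theorem PosteriorLipschitz.congr {d : Measure Z → Measure Z → ℝ} {P : Set (Measure Z)}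
    {F G : Measure Z → Measure Z} {K K' : Measure Z → ℝ} (hFG : ∀ μ ∈ P, G μ = F μ)
    (hK : ∀ μ ∈ P, K' μ = K μ) (h : PosteriorLipschitz d P F K) : PosteriorLipschitz d P G K' := by
  have hp : ∀ μ ∈ P, posterior G μ = posterior F μ := fun μ hμ => by
    simp only [posterior, evidence, hFG μ hμ]
  refine ⟨fun μ hμ => hp μ hμ ▸ h.1 μ hμ, fun μ hμ => ?_, fun μ hμ => ?_⟩
  · obtain ⟨c, hc, H⟩ := h.2.1 μ hμ
    exact ⟨c, hc, fun μ' hμ' => by rw [hp μ hμ, hp μ' hμ']; exact H μ' hμ'⟩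
  · rw [hK μ hμ]
    exact ⟨(h.2.2 μ hμ).1, fun μ' hμ' => by
      rw [hp μ hμ, hp μ' hμ']; exact (h.2.2 μ hμ).2 μ' hμ'⟩

end Posterior

/-! ### Total variation distance. -/

section TotalVariation

variable {Z : Type*} [MeasurableSpace Z]

theorem tvDist_nonneg (μ μ' : Measure Z) : 0 ≤ tvDist μ μ' :=
  Real.iSup_nonneg fun _ => abs_nonneg _

theorem abs_real_sub_le_tvDist (μ μ' : Measure Z) [IsFiniteMeasure μ] [IsFiniteMeasure μ']
    {A : Set Z} (hA : MeasurableSet A) : |μ.real A - μ'.real A| ≤ tvDist μ μ' := by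
  refine le_ciSup (f := fun A : {A : Set Z // MeasurableSet A} => |μ.real A.1 - μ'.real A.1|)
    ⟨μ.real univ + μ'.real univ, ?_⟩ ⟨A, hA⟩
  rintro _ ⟨B, rfl⟩
  have h1 : μ.real B.1 ≤ μ.real univ := measureReal_mono (subset_univ _)
  have h2 : μ'.real B.1 ≤ μ'.real univ := measureReal_mono (subset_univ _)
  have h3 : 0 ≤ μ.real B.1 := measureReal_nonneg
  have h4 : 0 ≤ μ'.real B.1 := measureReal_nonneg
  exact abs_le.2 ⟨by linarith, by linarith⟩

theorem restrict_le_restrict_of_subset {μ μ' : Measure Z} {s : Set Z} (hs : MeasurableSet s)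
    (h : ∀ t, MeasurableSet t → t ⊆ s → μ t ≤ μ' t) : μ.restrict s ≤ μ'.restrict s :=
  Measure.le_iff.2 fun t ht => by
    rw [Measure.restrict_apply ht, Measure.restrict_apply ht]
    exact h _ (ht.inter hs) inter_subset_right

/-- Only the oscillation `C` of `g` matters, not its sup norm. On the Hahn set `s`, where `μ ≥ μ'`,
replace `g` by its upper bound `m + C`; off `s` replace it by its lower bound `m`. Since both total
masses are 1, the difference of integrals is at most `C (μ(s) - μ'(s))`. -/
theorem integral_sub_integral_le_mul_tvDist (μ μ' : Measure Z) [IsProbabilityMeasure μ]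
    [IsProbabilityMeasure μ'] {g : Z → ℝ} (hg : Measurable g) {m C : ℝ} (hm : ∀ z, m ≤ g z)
    (hC : ∀ z, g z ≤ m + C) : ∫ z, g z ∂μ - ∫ z, g z ∂μ' ≤ C * tvDist μ μ' := by
  have hint : ∀ τ : Measure Z, IsFiniteMeasure τ → Integrable g τ := fun τ _ =>
    Integrable.of_mem_Icc m (m + C) hg.aemeasurable (ae_of_all _ fun z => ⟨hm z, hC z⟩)
  obtain ⟨s, hs, h1, h2⟩ := hahn_decomposition (μ := μ) (ν := μ')
  have e1 : ∀ (τ : Measure Z) [IsFiniteMeasure τ] (c : ℝ),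
      ∫ z, (g z - c) ∂τ = ∫ z, g z ∂τ - c * τ.real univ := fun τ _ c => by
    rw [integral_sub (hint τ inferInstance) (integrable_const c), integral_const, smul_eq_mul,
      mul_comm]
  have e2 : ∀ (τ : Measure Z) [IsFiniteMeasure τ] (c : ℝ),
      ∫ z, (c - g z) ∂τ = c * τ.real univ - ∫ z, g z ∂τ := fun τ _ c => by
    rw [integral_sub (integrable_const c) (hint τ inferInstance), integral_const, smul_eq_mul,
      mul_comm]
  have k1 : ∫ z in s, (m + C - g z) ∂μ' ≤ ∫ z in s, (m + C - g z) ∂μ :=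
    integral_mono_measure (restrict_le_restrict_of_subset hs h1)
      (ae_of_all _ fun z => sub_nonneg.2 (hC z))
      ((integrable_const _).sub (hint _ inferInstance))
  have k2 : ∫ z in sᶜ, (g z - m) ∂μ ≤ ∫ z in sᶜ, (g z - m) ∂μ' :=
    integral_mono_measure (restrict_le_restrict_of_subset hs.compl h2)
      (ae_of_all _ fun z => sub_nonneg.2 (hm z))
      ((hint _ inferInstance).sub (integrable_const _))
  rw [e2, e2] at k1
  rw [e1, e1] at k2
  simp only [measureReal_restrict_apply_univ] at k1 k2
  have a1 := integral_add_compl hs (hint μ inferInstance)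
  have a2 := integral_add_compl hs (hint μ' inferInstance)
  have b1 := probReal_add_probReal_compl (μ := μ) hs
  have b2 := probReal_add_probReal_compl (μ := μ') hs
  have hC0 : 0 ≤ C := by
    obtain ⟨z⟩ : Nonempty Z := μ.nonempty_of_neZero
    linarith [hm z, hC z]
  have key : ∫ z, g z ∂μ - ∫ z, g z ∂μ' ≤ C * (μ.real s - μ'.real s) := by
    rw [← a1, ← a2]
    have c1 : μ.real sᶜ = 1 - μ.real s := by linarith
    have c2 : μ'.real sᶜ = 1 - μ'.real s := by linarith
    rw [c1, c2] at k2
    linarith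
  exact key.trans (mul_le_mul_of_nonneg_left
    ((le_abs_self _).trans (abs_real_sub_le_tvDist μ μ' hs)) hC0)

variable {S : Type*} [MeasurableSpace S] {σ : Measure S} [SigmaFinite σ] {q : Z × S → ℝ≥0}
  {e : Z × S → Z}

theorem posterior_real_sub_le_tvDist (hq : Measurable q) (he : Measurable e) {C : ℝ≥0∞}
    (hC : C ≠ ∞) (hqC : ∀ z, ∫⁻ s, q (z, s) ∂σ ≤ C) (μ μ' : Measure Z) [IsProbabilityMeasure μ]
    [IsProbabilityMeasure μ'] (h0 : evidence (pushUnnorm σ q e) μ ≠ 0)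
    (h0' : evidence (pushUnnorm σ q e) μ' ≠ 0) {A : Set Z} (hA : MeasurableSet A) :
    (posterior (pushUnnorm σ q e) μ).real A - (posterior (pushUnnorm σ q e) μ').real A ≤
      C.toReal / (evidence (pushUnnorm σ q e) μ).toReal * tvDist μ μ' := by
  -- `Φ B z` is the mass that the kernel sends from `z` into `B`, so `Φ A + Φ Aᶜ ≤ C` pointwise.
  set Φ : Set Z → Z → ℝ≥0∞ := fun B z => ∫⁻ s, q (z, s) * B.indicator 1 (e (z, s)) ∂σ with hΦ
  have mΦ : ∀ {B}, MeasurableSet B → Measurable (Φ B) := fun {B} hB => by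
    have : Measurable (B.indicator (1 : Z → ℝ≥0∞)) := measurable_one.indicator hB
    exact Measurable.lintegral_prod_right' (f := fun p => q p * B.indicator 1 (e p)) (by fun_prop)
  have hsum : ∀ z, Φ A z + Φ Aᶜ z ≤ C := fun z => by
    have : Measurable (A.indicator (1 : Z → ℝ≥0∞)) := measurable_one.indicator hA
    rw [hΦ, ← lintegral_add_left (by fun_prop)]
    refine le_trans (le_of_eq (lintegral_congr fun s => ?_)) (hqC z)
    by_cases h : e (z, s) ∈ A <;> simp [h]
  have hle : ∀ {B}, (B = A ∨ B = Aᶜ) → ∀ z, Φ B z ≤ C := by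
    rintro B (rfl | rfl) z
    · exact le_self_add.trans (hsum z)
    · exact le_add_self.trans (hsum z)
  have hint : ∀ {B}, (B = A ∨ B = Aᶜ) → ∀ τ : Measure Z, IsProbabilityMeasure τ →
      Integrable (fun z => (Φ B z).toReal) τ := fun {B} hB τ _ => by
    have hBm : MeasurableSet B := by rcases hB with rfl | rfl; exacts [hA, hA.compl]
    exact Integrable.of_mem_Icc 0 C.toReal (mΦ hBm).ennreal_toReal.aemeasurable
      (ae_of_all _ fun z => ⟨ENNReal.toReal_nonneg, ENNReal.toReal_mono hC (hle hB z)⟩)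
  have hval : ∀ {B}, (B = A ∨ B = Aᶜ) → ∀ τ : Measure Z, IsProbabilityMeasure τ →
      ∫ z, (Φ B z).toReal ∂τ = (pushUnnorm σ q e τ).real B := fun {B} hB τ _ => by
    have hBm : MeasurableSet B := by rcases hB with rfl | rfl; exacts [hA, hA.compl]
    rw [integral_toReal (mΦ hBm).aemeasurable
      (ae_of_all _ fun z => (hle hB z).trans_lt hC.lt_top), measureReal_def,
      pushUnnorm_apply hq he τ hBm]
  have hfin : ∀ τ : Measure Z, IsProbabilityMeasure τ → evidence (pushUnnorm σ q e) τ ≠ ∞ :=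
    fun τ _ => by
      rw [evidence, pushUnnorm_univ hq he]
      refine ((lintegral_mono hqC).trans_lt ?_).ne
      simpa using hC.lt_top
  have hadd : ∀ τ : Measure Z, IsProbabilityMeasure τ → (evidence (pushUnnorm σ q e) τ).toReal =
      (pushUnnorm σ q e τ).real A + (pushUnnorm σ q e τ).real Aᶜ := fun τ _ => by
    have : IsFiniteMeasure (pushUnnorm σ q e τ) := ⟨(hfin τ inferInstance).lt_top⟩
    exact (measureReal_add_measureReal_compl hA).symm
  have hpost : ∀ τ : Measure Z, (posterior (pushUnnorm σ q e) τ).real A =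
      (pushUnnorm σ q e τ).real A / (evidence (pushUnnorm σ q e) τ).toReal := fun τ => by
    rw [posterior, measureReal_ennreal_smul_apply, ENNReal.toReal_inv, div_eq_inv_mul]
  have hZ : 0 < (evidence (pushUnnorm σ q e) μ).toReal :=
    ENNReal.toReal_pos h0 (hfin μ inferInstance)
  have hZ' : 0 < (evidence (pushUnnorm σ q e) μ').toReal :=
    ENNReal.toReal_pos h0' (hfin μ' inferInstance)
  rw [hpost, hpost]
  have ha := hadd μ inferInstance
  have hb := hadd μ' inferInstance
  set Zm := (evidence (pushUnnorm σ q e) μ).toReal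
  set Zm' := (evidence (pushUnnorm σ q e) μ').toReal
  set p := (pushUnnorm σ q e μ').real A / Zm' with hp
  have hp0 : 0 ≤ p := div_nonneg measureReal_nonneg hZ'.le
  have hp1 : p ≤ 1 := (div_le_one hZ').2 (by
    have : 0 ≤ (pushUnnorm σ q e μ').real Aᶜ := measureReal_nonneg
    linarith)
  have hsum' : ∀ z, (Φ A z).toReal + (Φ Aᶜ z).toReal ≤ C.toReal := fun z => by
    rw [← ENNReal.toReal_add ((hle (.inl rfl) z).trans_lt hC.lt_top).ne
      ((hle (.inr rfl) z).trans_lt hC.lt_top).ne]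
    exact ENNReal.toReal_mono hC (hsum z)
  -- The values of `(1 - p) Φ A - p Φ Aᶜ` lie in `[-pC, (1 - p)C]`, an interval of length `C`; this
  -- is what avoids a factor 2 in the constant.
  have key := integral_sub_integral_le_mul_tvDist μ μ'
    (g := fun z => (1 - p) * (Φ A z).toReal - p * (Φ Aᶜ z).toReal) (m := -p * C.toReal)
    (C := C.toReal)
    (((mΦ hA).ennreal_toReal.const_mul _).sub ((mΦ hA.compl).ennreal_toReal.const_mul _))
    (fun z => by
      have i1 : 0 ≤ (Φ A z).toReal := ENNReal.toReal_nonneg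
      nlinarith [hsum' z, mul_nonneg (sub_nonneg.2 hp1) i1, mul_nonneg hp0 i1,
        mul_le_mul_of_nonneg_left (hsum' z) hp0])
    (fun z => by
      have i1 : 0 ≤ (Φ Aᶜ z).toReal := ENNReal.toReal_nonneg
      nlinarith [hsum' z, mul_nonneg (sub_nonneg.2 hp1) i1, mul_nonneg hp0 i1,
        mul_le_mul_of_nonneg_left (hsum' z) (sub_nonneg.2 hp1)])
  have hI : ∀ τ : Measure Z, IsProbabilityMeasure τ →
      ∫ z, ((1 - p) * (Φ A z).toReal - p * (Φ Aᶜ z).toReal) ∂τ =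
      (1 - p) * (pushUnnorm σ q e τ).real A - p * (pushUnnorm σ q e τ).real Aᶜ := fun τ _ => by
    rw [integral_sub ((hint (.inl rfl) τ inferInstance).const_mul _)
      ((hint (.inr rfl) τ inferInstance).const_mul _), integral_const_mul, integral_const_mul,
      hval (.inl rfl) τ inferInstance, hval (.inr rfl) τ inferInstance]
  rw [hI μ inferInstance, hI μ' inferInstance] at key
  -- Together with `hb` this says that the test function has `μ'`-integral zero.
  have hpZ : p * Zm' = (pushUnnorm σ q e μ').real A := by rw [hp]; field_simp
  rw [sub_le_iff_le_add, div_le_iff₀ hZ]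
  have hr : (C.toReal / Zm * tvDist μ μ' + p) * Zm = C.toReal * tvDist μ μ' + p * Zm := by
    field_simp
  rw [hr, ha]
  rw [hb] at hpZ
  linarith

theorem tvDist_posterior_le (hq : Measurable q) (he : Measurable e) {C : ℝ≥0∞}
    (hC : C ≠ ∞) (hqC : ∀ z, ∫⁻ s, q (z, s) ∂σ ≤ C) (μ μ' : Measure Z) [IsProbabilityMeasure μ]
    [IsProbabilityMeasure μ'] (h0 : evidence (pushUnnorm σ q e) μ ≠ 0)
    (h1 : evidence (pushUnnorm σ q e) μ ≠ ∞) (h0' : evidence (pushUnnorm σ q e) μ' ≠ 0)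
    (h1' : evidence (pushUnnorm σ q e) μ' ≠ ∞) :
    tvDist (posterior (pushUnnorm σ q e) μ) (posterior (pushUnnorm σ q e) μ') ≤
      C.toReal / (evidence (pushUnnorm σ q e) μ).toReal * tvDist μ μ' := by
  have := isProbabilityMeasure_posterior h0 h1
  have := isProbabilityMeasure_posterior h0' h1'
  -- The one-sided estimate for `Aᶜ` is the other half of the absolute value, as both posteriors
  -- have mass 1.
  refine Real.iSup_le (fun A => abs_le.2 ⟨?_, ?_⟩)
    (mul_nonneg (by positivity) (tvDist_nonneg _ _))
  · have := posterior_real_sub_le_tvDist hq he hC hqC μ μ' h0 h0' A.2.compl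
    rw [probReal_compl_eq_one_sub A.2, probReal_compl_eq_one_sub A.2] at this
    linarith
  · exact posterior_real_sub_le_tvDist hq he hC hqC μ μ' h0 h0' A.2

end TotalVariation

/-! ### Couplings and the Wasserstein distance. -/

section Wasserstein

variable {Z : Type*} [MeasurableSpace Z] [MetricSpace Z]

theorem edist_le_ediam_univ {Z : Type*} [MetricSpace Z] (z z' : Z) : edist z z' ≤ Metric.ediam (univ : Set Z) :=
  Metric.edist_le_ediam_of_mem (mem_univ z) (mem_univ z')

/-- Keep the plan `κ` and complete it by the normalized product of the remainders, whose cost is at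
most the diameter times their common mass. Zero mass is separate, since the normalizing factor would
be infinite. -/
theorem iInf_couplings_le (κ : Measure (Z × Z)) (r₁ r₂ : Measure Z) [IsFiniteMeasure r₁]
    [IsFiniteMeasure r₂] (h : r₁ univ = r₂ univ) :
    ⨅ γ ∈ couplings (κ.map Prod.fst + r₁) (κ.map Prod.snd + r₂), ∫⁻ p, edist p.1 p.2 ∂γ ≤
      ∫⁻ p, edist p.1 p.2 ∂κ + Metric.ediam (univ : Set Z) * r₁ univ := by
  have hR : r₁ univ ≠ ∞ := measure_ne_top _ _
  rcases eq_or_ne (r₁ univ) 0 with h0 | h0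
  · have e1 : r₁ = 0 := Measure.measure_univ_eq_zero.1 h0
    have e2 : r₂ = 0 := Measure.measure_univ_eq_zero.1 (h ▸ h0)
    simpa [e1, e2] using iInf₂_le (f := fun γ (_ : γ ∈ couplings (κ.map Prod.fst)
      (κ.map Prod.snd)) => ∫⁻ p, edist p.1 p.2 ∂γ) κ ⟨rfl, rfl⟩
  refine (iInf₂_le (κ + (r₁ univ)⁻¹ • r₁.prod r₂) (show _ ∧ _ from ⟨?_, ?_⟩)).trans ?_
  · rw [Measure.map_add _ _ measurable_fst, Measure.map_smul, Measure.map_fst_prod, ← h, smul_smul,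
      ENNReal.inv_mul_cancel h0 hR, one_smul]
  · rw [Measure.map_add _ _ measurable_snd, Measure.map_smul, Measure.map_snd_prod, smul_smul,
      ENNReal.inv_mul_cancel h0 hR, one_smul]
  · rw [lintegral_add_measure, lintegral_smul_measure]
    gcongr
    calc (r₁ univ)⁻¹ • ∫⁻ p, edist p.1 p.2 ∂(r₁.prod r₂)
        ≤ (r₁ univ)⁻¹ • ∫⁻ _, Metric.ediam (univ : Set Z) ∂(r₁.prod r₂) := by
          gcongr with p; exact edist_le_ediam_univ _ _
      _ = Metric.ediam (univ : Set Z) * r₁ univ := by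
          rw [lintegral_const, ← univ_prod_univ, Measure.prod_prod, ← h, smul_eq_mul,
            mul_left_comm, ← mul_assoc (r₁ univ)⁻¹, ENNReal.inv_mul_cancel h0 hR, one_mul]

end Wasserstein

/-! ### Transport between two posteriors. -/

section Transport

variable {Z Z₁ S : Type*} [MeasurableSpace Z] [MeasurableSpace Z₁] [MeasurableSpace S]
  {σ : Measure S} [SigmaFinite σ] {q : Z × S → ℝ≥0} {e : Z × S → Z}

/-- With `f` a coordinate projection and `γ` a coupling, this realizes both posteriors as images of
weighted versions of the same measure `γ ⊗ σ`, where the weights can be compared pointwise. -/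
theorem map_withDensity_prod_eq_smul_pushUnnorm (hq : Measurable q) (he : Measurable e)
    (γ : Measure Z₁) [SFinite γ] {f : Z₁ → Z} (hf : Measurable f) (a : ℝ≥0∞) :
    ((γ.prod σ).withDensity fun p => a * q (f p.1, p.2)).map (fun p => e (f p.1, p.2)) =
      a • pushUnnorm σ q e (γ.map f) := by
  ext A hA
  have mA : Measurable (A.indicator (1 : Z → ℝ≥0∞)) := measurable_one.indicator hA
  rw [Measure.smul_apply, pushUnnorm_apply hq he _ hA, ← lintegral_indicator_one hA,
    lintegral_map mA (by fun_prop),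
    lintegral_withDensity_eq_lintegral_mul _ (by fun_prop) (by fun_prop),
    lintegral_prod _ (by fun_prop), lintegral_map
      (Measurable.lintegral_prod_right' (f := fun p => q p * A.indicator 1 (e p)) (by fun_prop)) hf,
    smul_eq_mul, ← lintegral_const_mul _ (Measurable.lintegral_prod_right'
      (f := fun p : Z₁ × S => q (f p.1, p.2) * A.indicator 1 (e (f p.1, p.2))) (by fun_prop))]
  refine lintegral_congr fun z => ?_
  rw [← lintegral_const_mul _ (by fun_prop)]
  simp only [Pi.mul_apply, mul_assoc]

variable [MetricSpace Z] [PolishSpace Z] [BorelSpace Z]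

/-- `B` bounds the cost of moving the shared mass from `e(z, s)` to `e(z', s)`; `L` bounds the mass
that cannot be shared because the weights `q(z, s)` and `q(z', s)` differ. -/
theorem iInf_couplings_posterior_le (hq : Measurable q) (he : Measurable e) {B L : ℝ≥0∞}
    (hB : ∀ z z', ∫⁻ s, q (z, s) * edist (e (z, s)) (e (z', s)) ∂σ ≤ B * edist z z')
    (hL : ∀ z z', ∫⁻ s, edist (q (z, s)) (q (z', s)) ∂σ ≤ L * edist z z')
    {μ μ' : Measure Z} [IsProbabilityMeasure μ]
    (h0 : evidence (pushUnnorm σ q e) μ ≠ 0) (h1 : evidence (pushUnnorm σ q e) μ ≠ ∞)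
    (h0' : evidence (pushUnnorm σ q e) μ' ≠ 0) (h1' : evidence (pushUnnorm σ q e) μ' ≠ ∞)
    {γ : Measure (Z × Z)} (hγ : γ ∈ couplings μ μ') :
    ⨅ η ∈ couplings (posterior (pushUnnorm σ q e) μ) (posterior (pushUnnorm σ q e) μ'),
      ∫⁻ p, edist p.1 p.2 ∂η ≤
    (evidence (pushUnnorm σ q e) μ)⁻¹ * (B + Metric.ediam (univ : Set Z) * L) *
      ∫⁻ p, edist p.1 p.2 ∂γ := by
  have hpr := isProbabilityMeasure_posterior h0 h1
  have hpr' := isProbabilityMeasure_posterior h0' h1'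
  have : IsProbabilityMeasure γ := ⟨by
    have := measure_univ (μ := μ)
    rwa [← hγ.1, Measure.map_apply measurable_fst MeasurableSet.univ, preimage_univ] at this⟩
  have hp : posterior (pushUnnorm σ q e) μ = (evidence (pushUnnorm σ q e) μ)⁻¹ •
    pushUnnorm σ q e (γ.map Prod.fst) := by rw [hγ.1, posterior]
  have hp' : posterior (pushUnnorm σ q e) μ' = (evidence (pushUnnorm σ q e) μ')⁻¹ •
    pushUnnorm σ q e (γ.map Prod.snd) := by rw [hγ.2, posterior]
  set a := (evidence (pushUnnorm σ q e) μ)⁻¹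
  set b := (evidence (pushUnnorm σ q e) μ')⁻¹
  rw [← map_withDensity_prod_eq_smul_pushUnnorm hq he γ measurable_fst] at hp
  rw [← map_withDensity_prod_eq_smul_pushUnnorm hq he γ measurable_snd] at hp'
  set Γ := γ.prod σ
  set u : (Z × Z) × S → ℝ≥0∞ := fun p => a * q (p.1.1, p.2) with hu
  set v : (Z × Z) × S → ℝ≥0∞ := fun p => b * q (p.1.2, p.2) with hv
  set m : (Z × Z) × S → ℝ≥0∞ := fun p => min (u p) (v p) with hm
  have mu : Measurable u := by fun_prop
  have mv : Measurable v := by fun_prop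
  have mm : Measurable m := mu.min mv
  set κ := (Γ.withDensity m).map fun p => (e (p.1.1, p.2), e (p.1.2, p.2)) with hκ
  set r₁ := (Γ.withDensity fun p => u p - v p).map fun p => e (p.1.1, p.2) with hr₁
  set r₂ := (Γ.withDensity fun p => v p - u p).map fun p => e (p.1.2, p.2) with hr₂
  have e1 : posterior (pushUnnorm σ q e) μ = κ.map Prod.fst + r₁ := by
    rw [hp, hκ, hr₁, Measure.map_map measurable_fst (by fun_prop),
      show (Prod.fst ∘ fun p : (Z × Z) × S => (e (p.1.1, p.2), e (p.1.2, p.2))) =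
        fun p => e (p.1.1, p.2) from rfl,
      ← Measure.map_add _ _ (by fun_prop), ← withDensity_add_left mm]
    congr 2
    funext p
    rcases le_total (u p) (v p) with h | h <;> simp [hm, h, add_tsub_cancel_of_le, tsub_eq_zero_of_le]
  have e2 : posterior (pushUnnorm σ q e) μ' = κ.map Prod.snd + r₂ := by
    rw [hp', hκ, hr₂, Measure.map_map measurable_snd (by fun_prop),
      show (Prod.snd ∘ fun p : (Z × Z) × S => (e (p.1.1, p.2), e (p.1.2, p.2))) =
        fun p => e (p.1.2, p.2) from rfl,
      ← Measure.map_add _ _ (by fun_prop), ← withDensity_add_left mm]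
    congr 2
    funext p
    rcases le_total (u p) (v p) with h | h <;> simp [hm, h, add_tsub_cancel_of_le, tsub_eq_zero_of_le]
  have t1 : κ univ + r₁ univ = 1 := by
    rw [← measure_univ (μ := posterior (pushUnnorm σ q e) μ), e1, Measure.add_apply,
      Measure.map_apply measurable_fst MeasurableSet.univ, preimage_univ]
  have t2 : κ univ + r₂ univ = 1 := by
    rw [← measure_univ (μ := posterior (pushUnnorm σ q e) μ'), e2, Measure.add_apply,
      Measure.map_apply measurable_snd MeasurableSet.univ, preimage_univ]
  have f1 : IsFiniteMeasure r₁ := ⟨(le_add_self.trans t1.le).trans_lt ENNReal.one_lt_top⟩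
  have f2 : IsFiniteMeasure r₂ := ⟨(le_add_self.trans t2.le).trans_lt ENNReal.one_lt_top⟩
  have hR : r₁ univ = r₂ univ := (ENNReal.add_right_inj
    ((le_self_add.trans t1.le).trans_lt ENNReal.one_lt_top).ne).1 (t1.trans t2.symm)
  have hbound : ∀ {w : (Z × Z) × S → ℝ≥0∞}, (∀ p, w p ≤ a * edist (q (p.1.1, p.2)) (q (p.1.2, p.2)))
      → ∫⁻ p, w p ∂Γ ≤ a * L * ∫⁻ p, edist p.1 p.2 ∂γ := fun {w} hw => by
    refine (lintegral_mono hw).trans ?_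
    rw [lintegral_prod _ (by fun_prop), ← lintegral_const_mul _ (by fun_prop)]
    refine lintegral_mono fun p => ?_
    dsimp only
    rw [lintegral_const_mul _ (by fun_prop), mul_assoc]
    gcongr
    exact hL _ _
  -- The two remainders have equal mass, so either may be estimated. Choosing by the order of `a`
  -- and `b` allows `b` to be replaced by `a`: if `a ≤ b` then `aq - bq' ≤ a(q - q')`, and if `b ≤
  -- a` then `bq' - aq ≤ a(q' - q)`. Hence `Z(μ')` disappears from the bound.
  have hRle : r₁ univ ≤ a * L * ∫⁻ p, edist p.1 p.2 ∂γ := by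
    have hsub : ∀ x y : ℝ≥0, (x : ℝ≥0∞) - y ≤ edist x y := fun x y => by
      rw [edist_nndist, NNReal.nndist_eq, ← ENNReal.coe_sub]
      exact_mod_cast le_max_left _ _
    rcases le_total a b with hab | hab
    · rw [hr₁, Measure.map_apply (by fun_prop) MeasurableSet.univ, preimage_univ,
        withDensity_apply _ MeasurableSet.univ, Measure.restrict_univ]
      refine hbound fun p => ?_
      calc u p - v p ≤ a * q (p.1.1, p.2) - a * q (p.1.2, p.2) := by
            simp only [hu, hv]; gcongr
        _ = a * (q (p.1.1, p.2) - q (p.1.2, p.2)) :=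
            (ENNReal.mul_sub fun _ _ => ENNReal.inv_ne_top.2 h0).symm
        _ ≤ _ := by gcongr; exact hsub _ _
    · rw [hR, hr₂, Measure.map_apply (by fun_prop) MeasurableSet.univ, preimage_univ,
        withDensity_apply _ MeasurableSet.univ, Measure.restrict_univ]
      refine hbound fun p => ?_
      calc v p - u p ≤ a * q (p.1.2, p.2) - a * q (p.1.1, p.2) := by
            simp only [hu, hv]; gcongr
        _ = a * (q (p.1.2, p.2) - q (p.1.1, p.2)) :=
            (ENNReal.mul_sub fun _ _ => ENNReal.inv_ne_top.2 h0).symm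
        _ ≤ _ := by rw [edist_comm]; gcongr; exact hsub _ _
  have hκle : ∫⁻ p, edist p.1 p.2 ∂κ ≤ a * B * ∫⁻ p, edist p.1 p.2 ∂γ := by
    rw [hκ, lintegral_map (by fun_prop) (by fun_prop),
      lintegral_withDensity_eq_lintegral_mul _ mm (by fun_prop), lintegral_prod _ (by fun_prop),
      ← lintegral_const_mul _ (by fun_prop)]
    refine lintegral_mono fun p => ?_
    calc ∫⁻ s, (m * fun p : (Z × Z) × S => edist (e (p.1.1, p.2)) (e (p.1.2, p.2))) (p, s) ∂σ
        ≤ ∫⁻ s, a * (q (p.1, s) * edist (e (p.1, s)) (e (p.2, s))) ∂σ := by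
          refine lintegral_mono fun s => ?_
          rw [Pi.mul_apply, ← mul_assoc]
          gcongr
          exact min_le_left _ _
      _ ≤ a * B * edist p.1 p.2 := by
          rw [lintegral_const_mul _ (by fun_prop), mul_assoc]
          gcongr
          exact hB _ _
  rw [e1, e2]
  calc _ ≤ _ := iInf_couplings_le κ r₁ r₂ hR
    _ ≤ a * B * ∫⁻ p, edist p.1 p.2 ∂γ +
        Metric.ediam (univ : Set Z) * (a * L * ∫⁻ p, edist p.1 p.2 ∂γ) := by gcongr
    _ = _ := by ring

theorem wasserstein1_posterior_le (hq : Measurable q) (he : Measurable e) {B L K : ℝ≥0∞}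
    (hB : ∀ z z', ∫⁻ s, q (z, s) * edist (e (z, s)) (e (z', s)) ∂σ ≤ B * edist z z')
    (hL : ∀ z z', ∫⁻ s, edist (q (z, s)) (q (z', s)) ∂σ ≤ L * edist z z')
    (hD : Metric.ediam (univ : Set Z) < ∞) (hK : B + Metric.ediam (univ : Set Z) * L ≤ K)
    (hK' : K ≠ ∞) {μ μ' : Measure Z} [IsProbabilityMeasure μ] [IsProbabilityMeasure μ']
    (h0 : evidence (pushUnnorm σ q e) μ ≠ 0) (h1 : evidence (pushUnnorm σ q e) μ ≠ ∞)
    (h0' : evidence (pushUnnorm σ q e) μ' ≠ 0) (h1' : evidence (pushUnnorm σ q e) μ' ≠ ∞) :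
    wasserstein1 (posterior (pushUnnorm σ q e) μ) (posterior (pushUnnorm σ q e) μ') ≤
      K.toReal / (evidence (pushUnnorm σ q e) μ).toReal * wasserstein1 μ μ' := by
  set c := (evidence (pushUnnorm σ q e) μ)⁻¹ * K with hc
  have hcT : c ≠ ∞ := ENNReal.mul_ne_top (ENNReal.inv_ne_top.2 h0) hK'
  have hprod : μ.prod μ' ∈ couplings μ μ' := ⟨by simp, by simp⟩
  -- The product coupling costs at most the diameter, so `toReal` does not collapse an infinite
  -- value to 0.
  have hfin : ⨅ γ ∈ couplings μ μ', ∫⁻ p, edist p.1 p.2 ∂γ ≠ ∞ := by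
    refine ((iInf₂_le _ hprod).trans_lt (lt_of_le_of_lt
      (lintegral_mono fun p : Z × Z => edist_le_ediam_univ p.1 p.2) ?_)).ne
    simpa using hD
  have hle : ⨅ η ∈ couplings (posterior (pushUnnorm σ q e) μ) (posterior (pushUnnorm σ q e) μ'),
      ∫⁻ p, edist p.1 p.2 ∂η ≤ c * ⨅ γ ∈ couplings μ μ', ∫⁻ p, edist p.1 p.2 ∂γ := by
    have : Nonempty (couplings μ μ') := ⟨_, hprod⟩
    rw [iInf_subtype' (f := fun γ (_ : γ ∈ couplings μ μ') => ∫⁻ p, edist p.1 p.2 ∂γ),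
      ENNReal.mul_iInf (fun h => absurd h hcT)]
    refine le_iInf fun γ => (iInf_couplings_posterior_le hq he hB hL h0 h1 h0' h1' γ.2).trans ?_
    rw [hc]
    gcongr
  have := ENNReal.toReal_mono (ENNReal.mul_ne_top hcT hfin) hle
  rwa [ENNReal.toReal_mul, hc, ENNReal.toReal_mul, ENNReal.toReal_inv, ← div_eq_inv_mul] at this

end Transport

/-! ### The variational formula for the geometric mean. -/

section GeometricMean

/-- The geometric mean of `x` and `y`, with the value `0` when one of them is infinite. -/
noncomputable def geomMean (x y : ℝ≥0∞) : ℝ≥0 := NNReal.sqrt x.toNNReal * NNReal.sqrt y.toNNReal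

theorem coe_geomMean (x y : ℝ≥0∞) : (geomMean x y : ℝ) = √x.toReal * √y.toReal := by
  simp [geomMean, ENNReal.toReal]

@[fun_prop]
theorem measurable_geomMean {α : Type*} [MeasurableSpace α] {f g : α → ℝ≥0∞} (hf : Measurable f)
    (hg : Measurable g) : Measurable fun a => geomMean (f a) (g a) :=
  (NNReal.continuous_sqrt.measurable.comp hf.ennreal_toNNReal).mul
    (NNReal.continuous_sqrt.measurable.comp hg.ennreal_toNNReal)

/-- This is `(t√x - √y)² ≥ 0` divided by `t`. The endpoints `t = 0` and `t = ∞` are admitted because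
the optimal `t` takes these values when exactly one of `x`, `y` vanishes. -/
theorem two_mul_geomMean_le (x y t : ℝ≥0∞) : 2 * (geomMean x y : ℝ≥0∞) ≤ t * x + t⁻¹ * y := by
  rcases eq_or_ne x 0 with rfl | hx
  · simp [geomMean]
  rcases eq_or_ne y 0 with rfl | hy
  · simp [geomMean]
  induction x with
  | top => simp [geomMean]
  | coe x =>
  induction y with
  | top => simp [geomMean]
  | coe y =>
  rcases eq_or_ne t 0 with rfl | ht
  · simp [hy]
  induction t with
  | top => simp [ENNReal.top_mul hx]
  | coe t =>
  have ht' : t ≠ 0 := by simpa using ht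
  rw [← ENNReal.coe_inv ht', geomMean, ENNReal.toNNReal_coe, ENNReal.toNNReal_coe]
  norm_cast
  rw [← NNReal.coe_le_coe]
  push_cast
  have htp : (0 : ℝ) < t := by positivity
  have ex := Real.sq_sqrt x.coe_nonneg
  have ey := Real.sq_sqrt y.coe_nonneg
  set a := √(x : ℝ)
  set b := √(y : ℝ)
  rw [← ex, ← ey]
  have h : (t : ℝ) * a ^ 2 + (t : ℝ)⁻¹ * b ^ 2 - 2 * (a * b) = (t * a - b) ^ 2 / t := by
    field_simp; ring
  have : 0 ≤ (t * a - b) ^ 2 / t := by positivity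
  linarith

/-- The minimizer is `t = √(y/x)`; at zeros of `x` or `y` the formula survives through `0 * ∞ = 0`.
-/
theorem two_mul_geomMean_eq {x y : ℝ≥0∞} (hx : x ≠ ∞) (hy : y ≠ ∞) :
    ((NNReal.sqrt y.toNNReal : ℝ≥0∞) / NNReal.sqrt x.toNNReal) * x +
      ((NNReal.sqrt y.toNNReal : ℝ≥0∞) / NNReal.sqrt x.toNNReal)⁻¹ * y =
      2 * (geomMean x y : ℝ≥0∞) := by
  lift x to ℝ≥0 using hx
  lift y to ℝ≥0 using hy
  rcases eq_or_ne x 0 with rfl | hx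
  · rcases eq_or_ne y 0 with rfl | hy
    · simp [geomMean]
    · simp [geomMean, ENNReal.div_zero, hy]
  rcases eq_or_ne y 0 with rfl | hy
  · simp [geomMean]
  have hx' : NNReal.sqrt x ≠ 0 := by simpa
  have hy' : NNReal.sqrt y ≠ 0 := by simpa
  rw [geomMean, ENNReal.toNNReal_coe, ENNReal.toNNReal_coe, ← ENNReal.coe_div hx',
    ← ENNReal.coe_inv (div_ne_zero hy' hx')]
  norm_cast
  have ex := NNReal.sq_sqrt x
  have ey := NNReal.sq_sqrt y
  set a := NNReal.sqrt x
  set b := NNReal.sqrt y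
  rw [← ex, ← ey]
  field_simp
  ring

end GeometricMean

/-! ### Hellinger distance. -/

section Hellinger

variable {Z : Type*} [MeasurableSpace Z]

theorem hellingerDist_nonneg (μ μ' : Measure Z) : 0 ≤ hellingerDist μ μ' := Real.sqrt_nonneg _

theorem integrable_mul_geomMean_rnDeriv (ν μ μ' : Measure Z) [IsFiniteMeasure μ]
    [IsFiniteMeasure μ'] {M : Z → ℝ} (hM : Measurable M) {C : ℝ} (h0 : ∀ z, 0 ≤ M z)
    (hC : ∀ z, M z ≤ C) :
    Integrable (fun z => M z * geomMean (μ.rnDeriv ν z) (μ'.rnDeriv ν z)) ν := by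
  refine ((((Measure.integrable_toReal_rnDeriv (μ := μ) (ν := ν)).add
    (Measure.integrable_toReal_rnDeriv (μ := μ') (ν := ν))).const_mul C)).mono'
    (by fun_prop) (ae_of_all _ fun z => ?_)
  rw [Real.norm_of_nonneg (mul_nonneg (h0 z) (NNReal.coe_nonneg _)), coe_geomMean]
  refine mul_le_mul (hC z) ?_ (by positivity) ((h0 z).trans (hC z))
  have ex := Real.sq_sqrt (ENNReal.toReal_nonneg (a := μ.rnDeriv ν z))
  have ey := Real.sq_sqrt (ENNReal.toReal_nonneg (a := μ'.rnDeriv ν z))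
  simp only [Pi.add_apply]
  nlinarith [sq_nonneg (√(μ.rnDeriv ν z).toReal - √(μ'.rnDeriv ν z).toReal),
    sq_nonneg √(μ.rnDeriv ν z).toReal, sq_nonneg √(μ'.rnDeriv ν z).toReal]

theorem integrable_mul_toReal_rnDeriv (ν μ : Measure Z) [IsFiniteMeasure μ]
    {M : Z → ℝ} (hM : Measurable M) {C : ℝ} (h0 : ∀ z, 0 ≤ M z) (hC : ∀ z, M z ≤ C) :
    Integrable (fun z => M z * (μ.rnDeriv ν z).toReal) ν :=
  Measure.integrable_toReal_rnDeriv.bdd_mul hM.aestronglyMeasurable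
    (ae_of_all _ fun z => by rw [Real.norm_of_nonneg (h0 z)]; exact hC z)

theorem mul_sq_sqrt_sub_sqrt (c : ℝ) (x y : ℝ≥0∞) : c * (√x.toReal - √y.toReal) ^ 2 =
    c * x.toReal + c * y.toReal - 2 * (c * geomMean x y) := by
  have ex := Real.sq_sqrt (ENNReal.toReal_nonneg (a := x))
  have ey := Real.sq_sqrt (ENNReal.toReal_nonneg (a := y))
  rw [coe_geomMean]
  linear_combination c * ex + c * ey

theorem integrable_mul_sq_sqrt_sub_sqrt (ν μ μ' : Measure Z) [IsFiniteMeasure μ]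
    [IsFiniteMeasure μ'] {M : Z → ℝ} (hM : Measurable M) {C : ℝ} (h0 : ∀ z, 0 ≤ M z)
    (hC : ∀ z, M z ≤ C) : Integrable
      (fun z => M z * (√(μ.rnDeriv ν z).toReal - √(μ'.rnDeriv ν z).toReal) ^ 2) ν := by
  simp only [mul_sq_sqrt_sub_sqrt]
  exact ((integrable_mul_toReal_rnDeriv ν μ hM h0 hC).add
    (integrable_mul_toReal_rnDeriv ν μ' hM h0 hC)).sub
    ((integrable_mul_geomMean_rnDeriv ν μ μ' hM h0 hC).const_mul 2)

/-- `M = 1` gives the Hellinger distance in terms of the affinity; `M` the kernel mass gives the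
unnormalized distance before the pushforward. -/
theorem integral_mul_sq_sqrt_sub_sqrt (ν μ μ' : Measure Z) [SigmaFinite ν] [IsFiniteMeasure μ]
    [IsFiniteMeasure μ'] (h : μ ≪ ν) (h' : μ' ≪ ν) {M : Z → ℝ} (hM : Measurable M) {C : ℝ}
    (h0 : ∀ z, 0 ≤ M z) (hC : ∀ z, M z ≤ C) :
    ∫ z, M z * (√(μ.rnDeriv ν z).toReal - √(μ'.rnDeriv ν z).toReal) ^ 2 ∂ν =
      ∫ z, M z ∂μ + ∫ z, M z ∂μ' -
        2 * ∫ z, M z * geomMean (μ.rnDeriv ν z) (μ'.rnDeriv ν z) ∂ν := by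
  have e : ∀ τ : Measure Z, IsFiniteMeasure τ → τ ≪ ν →
      ∫ z, M z * (τ.rnDeriv ν z).toReal ∂ν = ∫ z, M z ∂τ := fun τ _ hτ => by
    rw [← integral_rnDeriv_smul hτ]
    simp only [smul_eq_mul, mul_comm]
  simp only [mul_sq_sqrt_sub_sqrt]
  have i1 := integrable_mul_toReal_rnDeriv ν μ hM h0 hC
  have i2 := integrable_mul_toReal_rnDeriv ν μ' hM h0 hC
  have i3 : Integrable (fun z => M z * (μ.rnDeriv ν z).toReal + M z * (μ'.rnDeriv ν z).toReal) ν :=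
    i1.add i2
  rw [integral_sub i3 ((integrable_mul_geomMean_rnDeriv ν μ μ' hM h0 hC).const_mul 2),
    integral_const_mul, integral_add i1 i2, e μ inferInstance h, e μ' inferInstance h']

theorem hellingerDistWrt_sq (ν μ μ' : Measure Z) [SigmaFinite ν] [IsProbabilityMeasure μ]
    [IsProbabilityMeasure μ'] (h : μ ≪ ν) (h' : μ' ≪ ν) :
    hellingerDistWrt ν μ μ' ^ 2 =
      1 - ∫ z, (geomMean (μ.rnDeriv ν z) (μ'.rnDeriv ν z) : ℝ) ∂ν := by
  have := integral_mul_sq_sqrt_sub_sqrt ν μ μ' h h' (M := fun _ => 1) (C := 1) measurable_const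
    (fun _ => zero_le_one) (fun _ => le_rfl)
  simp only [one_mul, integral_const, probReal_univ, smul_eq_mul, mul_one] at this
  rw [hellingerDistWrt, Real.sq_sqrt (mul_nonneg (by norm_num)
    (integral_nonneg fun _ => sq_nonneg _)), this]
  ring

variable {S : Type*} [MeasurableSpace S] {σ : Measure S} [SigmaFinite σ] {q : Z × S → ℝ≥0}
  {e : Z × S → Z}

/-- Data processing for the affinity. The geometric mean is an infimum over `t` of expressions
linear in the two densities, and linear integrals are carried exactly by the pushforward. A `t`
optimal on the target, pulled back by `e`, is merely a competitor on the source. -/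
theorem lintegral_geomMean_le_pushUnnorm (hq : Measurable q) (he : Measurable e)
    (ν μ μ' : Measure Z) [IsFiniteMeasure ν] [IsFiniteMeasure μ] [IsFiniteMeasure μ'] (h : μ ≪ ν)
    (h' : μ' ≪ ν) (ρ : Measure Z) [SigmaFinite ρ] [SigmaFinite (pushUnnorm σ q e μ)]
    [SigmaFinite (pushUnnorm σ q e μ')] (hρ : pushUnnorm σ q e μ ≪ ρ)
    (hρ' : pushUnnorm σ q e μ' ≪ ρ) :
    ∫⁻ z, (∫⁻ s, q (z, s) ∂σ) * geomMean (μ.rnDeriv ν z) (μ'.rnDeriv ν z) ∂ν ≤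
      ∫⁻ z, geomMean ((pushUnnorm σ q e μ).rnDeriv ρ z) ((pushUnnorm σ q e μ').rnDeriv ρ z) ∂ρ := by
  set f := μ.rnDeriv ν with hf
  set g := μ'.rnDeriv ν with hg
  set α := (pushUnnorm σ q e μ).rnDeriv ρ with hα
  set β := (pushUnnorm σ q e μ').rnDeriv ρ with hβ
  have mf : Measurable f := Measure.measurable_rnDeriv _ _
  have mg : Measurable g := Measure.measurable_rnDeriv _ _
  have mα : Measurable α := Measure.measurable_rnDeriv _ _
  have mβ : Measurable β := Measure.measurable_rnDeriv _ _
  set t : Z → ℝ≥0∞ := fun z =>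
    (NNReal.sqrt (β z).toNNReal : ℝ≥0∞) / NNReal.sqrt (α z).toNNReal with ht
  have mt : Measurable t :=
    (NNReal.continuous_sqrt.measurable.comp mβ.ennreal_toNNReal).coe_nnreal_ennreal.div
      (NNReal.continuous_sqrt.measurable.comp mα.ennreal_toNNReal).coe_nnreal_ennreal
  have hpush : ∀ (τ : Measure Z) (w : Z → ℝ≥0∞), IsFiniteMeasure τ → τ ≪ ν → Measurable w →
      SigmaFinite (pushUnnorm σ q e τ) → pushUnnorm σ q e τ ≪ ρ →
      ∫⁻ z, τ.rnDeriv ν z * ∫⁻ s, q (z, s) * w (e (z, s)) ∂σ ∂ν =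
        ∫⁻ z, (pushUnnorm σ q e τ).rnDeriv ρ z * w z ∂ρ := fun τ w _ hτ hw _ hτρ => by
    rw [lintegral_rnDeriv_mul hτ (Measurable.lintegral_prod_right'
        (f := fun p => q p * w (e p)) (by fun_prop)).aemeasurable,
      lintegral_rnDeriv_mul hτρ hw.aemeasurable, lintegral_pushUnnorm hq he τ hw]
  have h2 : (2 : ℝ≥0∞) * ∫⁻ z, (∫⁻ s, q (z, s) ∂σ) * geomMean (f z) (g z) ∂ν ≤
      2 * ∫⁻ z, geomMean (α z) (β z) ∂ρ := by
    calc (2 : ℝ≥0∞) * ∫⁻ z, (∫⁻ s, q (z, s) ∂σ) * geomMean (f z) (g z) ∂ν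
        = ∫⁻ z, ∫⁻ s, q (z, s) * (2 * geomMean (f z) (g z)) ∂σ ∂ν := by
          rw [← lintegral_const_mul' _ _ (by simp)]
          refine lintegral_congr fun z => ?_
          rw [lintegral_mul_const _ (by fun_prop)]
          ring
      _ ≤ ∫⁻ z, ∫⁻ s, q (z, s) * (t (e (z, s)) * f z + (t (e (z, s)))⁻¹ * g z) ∂σ ∂ν := by
          gcongr with z s
          exact two_mul_geomMean_le _ _ _
      _ = ∫⁻ z, (f z * ∫⁻ s, q (z, s) * t (e (z, s)) ∂σ +
            g z * ∫⁻ s, q (z, s) * (t (e (z, s)))⁻¹ ∂σ) ∂ν := by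
          refine lintegral_congr fun z => ?_
          rw [← lintegral_const_mul _ (by fun_prop), ← lintegral_const_mul _ (by fun_prop),
            ← lintegral_add_left (by fun_prop)]
          refine lintegral_congr fun s => ?_
          ring
      _ = ∫⁻ z, α z * t z ∂ρ + ∫⁻ z, β z * (t z)⁻¹ ∂ρ := by
          have mqt : Measurable fun z => f z * ∫⁻ s, q (z, s) * t (e (z, s)) ∂σ :=
            mf.mul (Measurable.lintegral_prod_right' (f := fun p => q p * t (e p)) (by fun_prop))
          rw [lintegral_add_left mqt,
            hpush μ t inferInstance h mt inferInstance hρ,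
            hpush μ' (fun z => (t z)⁻¹) inferInstance h' mt.inv inferInstance hρ']
      _ = ∫⁻ z, 2 * geomMean (α z) (β z) ∂ρ := by
          rw [← lintegral_add_left (by fun_prop)]
          refine lintegral_congr_ae ?_
          filter_upwards [Measure.rnDeriv_lt_top (pushUnnorm σ q e μ) ρ,
            Measure.rnDeriv_lt_top (pushUnnorm σ q e μ') ρ] with z hz hz'
          rw [← two_mul_geomMean_eq hz.ne hz'.ne, mul_comm, mul_comm (β z)]
      _ = 2 * ∫⁻ z, geomMean (α z) (β z) ∂ρ := lintegral_const_mul' _ _ (by simp)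
  exact (ENNReal.mul_le_mul_iff_right two_ne_zero ENNReal.ofNat_ne_top).1 h2

/-- `‖a/‖a‖ - b/‖b‖‖ ≤ 2‖a - b‖/‖a‖`, written in terms of `u = ‖a‖`, `v = ‖b‖`, `B = ⟨a, b⟩`. -/
theorem one_sub_div_mul_le {u v B : ℝ} (hu : 0 < u) (hv : 0 < v) (hB : 0 ≤ B) (hB' : B ≤ u * v) :
    1 - B / (u * v) ≤ 2 * (u ^ 2 + v ^ 2 - 2 * B) / u ^ 2 := by
  have huv := mul_pos hu hv
  rw [one_sub_div huv.ne', div_le_div_iff₀ huv (by positivity)]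
  -- The inequality is affine in `B`, so an endpoint of `[0, uv]` is the worst case: `B = uv` if `u
  -- ≤ 4v`, leaving `2v(u - v)² ≥ 0`, and `B = 0` otherwise.
  have key : u * (u * v - B) ≤ 2 * v * (u ^ 2 + v ^ 2 - 2 * B) := by
    rcases le_total u (4 * v) with h | h
    · nlinarith [mul_nonneg (sub_nonneg.2 h) (sub_nonneg.2 hB'),
        mul_nonneg hv.le (sq_nonneg (u - v))]
    · nlinarith [mul_nonneg (sub_nonneg.2 h) hB, mul_nonneg hv.le (sq_nonneg u),
        mul_nonneg hv.le (sq_nonneg v)]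
  nlinarith [mul_le_mul_of_nonneg_left key hu.le]

/-- With `u² = Z(μ)`, `v² = Z(μ')` and `B` the affinity of the unnormalized posteriors, the squared
distance is `1 - B/(uv) ≤ 2(u² + v² - 2B)/u²`. Data processing replaces `B` by the prior-side `B₀`,
and `u² + v² - 2B₀ = ∫ M (√f - √g)² ≤ 2C d_H(μ, μ')²`, which yields `4C/Z(μ)`. -/
theorem hellingerDist_posterior_le (hq : Measurable q) (he : Measurable e) {C : ℝ≥0∞}
    (hC : C ≠ ∞) (hqC : ∀ z, ∫⁻ s, q (z, s) ∂σ ≤ C) (μ μ' : Measure Z) [IsProbabilityMeasure μ]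
    [IsProbabilityMeasure μ'] (h0 : evidence (pushUnnorm σ q e) μ ≠ 0)
    (h1 : evidence (pushUnnorm σ q e) μ ≠ ∞) (h0' : evidence (pushUnnorm σ q e) μ' ≠ 0)
    (h1' : evidence (pushUnnorm σ q e) μ' ≠ ∞) :
    hellingerDist (posterior (pushUnnorm σ q e) μ) (posterior (pushUnnorm σ q e) μ') ≤
      2 * √(C.toReal / (evidence (pushUnnorm σ q e) μ).toReal) * hellingerDist μ μ' := by
  have hpr := isProbabilityMeasure_posterior h0 h1
  have hpr' := isProbabilityMeasure_posterior h0' h1'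
  have hfa : IsFiniteMeasure (pushUnnorm σ q e μ) := ⟨h1.lt_top⟩
  have hfb : IsFiniteMeasure (pushUnnorm σ q e μ') := ⟨h1'.lt_top⟩
  set a := pushUnnorm σ q e μ with ha
  set b := pushUnnorm σ q e μ' with hb
  set ρ := a + b with hρdef
  set ν := μ + μ' with hν
  have hμν : μ ≪ ν := (Measure.le_add_right le_rfl).absolutelyContinuous
  have hμν' : μ' ≪ ν := (Measure.le_add_left le_rfl).absolutelyContinuous
  have haρ : a ≪ ρ := (Measure.le_add_right le_rfl).absolutelyContinuous
  have hbρ : b ≪ ρ := (Measure.le_add_left le_rfl).absolutelyContinuous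
  set M : Z → ℝ≥0∞ := fun z => ∫⁻ s, q (z, s) ∂σ with hM
  have mM : Measurable M := Measurable.lintegral_prod_right' (f := fun p => (q p : ℝ≥0∞))
    (by fun_prop)
  have hMtop : ∀ z, M z < ∞ := fun z => (hqC z).trans_lt hC.lt_top
  have hMC : ∀ z, (M z).toReal ≤ C.toReal := fun z => ENNReal.toReal_mono hC (hqC z)
  have hMint : ∀ τ : Measure Z, IsProbabilityMeasure τ → ∫ z, (M z).toReal ∂τ =
      (evidence (pushUnnorm σ q e) τ).toReal := fun τ _ => by
    rw [integral_toReal mM.aemeasurable (ae_of_all _ hMtop), evidence, pushUnnorm_univ hq he]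
  have hevA : evidence (pushUnnorm σ q e) μ = a univ := rfl
  have hevB : evidence (pushUnnorm σ q e) μ' = b univ := rfl
  set B : ℝ := ∫ z, (geomMean (a.rnDeriv ρ z) (b.rnDeriv ρ z) : ℝ) ∂ρ with hB
  set B₀ : ℝ := ∫ z, (M z).toReal * (geomMean (μ.rnDeriv ν z) (μ'.rnDeriv ν z) : ℝ) ∂ν with hB₀
  have hBB : B₀ ≤ B := by
    have hle := lintegral_geomMean_le_pushUnnorm hq he ν μ μ' hμν hμν' ρ haρ hbρ
    have hfin : ∫⁻ z, (geomMean (a.rnDeriv ρ z) (b.rnDeriv ρ z) : ℝ≥0∞) ∂ρ ≠ ∞ := by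
      have := (integrable_mul_geomMean_rnDeriv ρ a b (M := fun _ => 1) (C := 1) measurable_const
        (fun _ => zero_le_one) (fun _ => le_rfl)).lintegral_lt_top
      simpa using this.ne
    have := ENNReal.toReal_mono hfin hle
    rw [← integral_toReal (by fun_prop) (ae_of_all _ fun z => by
        exact ENNReal.mul_lt_top (hMtop z) ENNReal.coe_lt_top),
      ← integral_toReal (by fun_prop) (ae_of_all _ fun z => ENNReal.coe_lt_top)] at this
    simpa [hB, hB₀] using this
  have hJ := integral_mul_sq_sqrt_sub_sqrt ν μ μ' hμν hμν' mM.ennreal_toReal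
    (fun _ => ENNReal.toReal_nonneg) hMC
  rw [hMint μ inferInstance, hMint μ' inferInstance] at hJ
  have hH : hellingerDist μ μ' ^ 2 =
      1 / 2 * ∫ z, (√(μ.rnDeriv ν z).toReal - √(μ'.rnDeriv ν z).toReal) ^ 2 ∂ν :=
    Real.sq_sqrt (mul_nonneg (by norm_num) (integral_nonneg fun _ => sq_nonneg _))
  have hJle : ∫ z, (M z).toReal * (√(μ.rnDeriv ν z).toReal - √(μ'.rnDeriv ν z).toReal) ^ 2 ∂ν ≤
      C.toReal * (2 * hellingerDist μ μ' ^ 2) := by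
    have h1 : C.toReal * (2 * hellingerDist μ μ' ^ 2) =
        ∫ z, C.toReal * (√(μ.rnDeriv ν z).toReal - √(μ'.rnDeriv ν z).toReal) ^ 2 ∂ν := by
      rw [integral_const_mul, hH]; ring
    rw [h1]
    refine integral_mono (integrable_mul_sq_sqrt_sub_sqrt ν μ μ' mM.ennreal_toReal
      (fun _ => ENNReal.toReal_nonneg) hMC) (integrable_mul_sq_sqrt_sub_sqrt ν μ μ'
      measurable_const (fun _ => ENNReal.toReal_nonneg) (fun _ => le_rfl)) fun z => ?_
    exact mul_le_mul_of_nonneg_right (hMC z) (sq_nonneg _)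
  have hpaρ : posterior (pushUnnorm σ q e) μ ≪ ρ := haρ.smul_left _
  have hpbρ : posterior (pushUnnorm σ q e) μ' ≪ ρ := hbρ.smul_left _
  have hZ : 0 < (evidence (pushUnnorm σ q e) μ).toReal := ENNReal.toReal_pos h0 h1
  have hZ' : 0 < (evidence (pushUnnorm σ q e) μ').toReal := ENNReal.toReal_pos h0' h1'
  have hpost := hellingerDistWrt_sq ρ (posterior (pushUnnorm σ q e) μ)
    (posterior (pushUnnorm σ q e) μ') hpaρ hpbρ
  have haff : ∫ z, (geomMean ((posterior (pushUnnorm σ q e) μ).rnDeriv ρ z)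
      ((posterior (pushUnnorm σ q e) μ').rnDeriv ρ z) : ℝ) ∂ρ =
      B / (√(evidence (pushUnnorm σ q e) μ).toReal * √(evidence (pushUnnorm σ q e) μ').toReal) := by
    rw [hB, ← integral_div]
    refine integral_congr_ae ?_
    filter_upwards [Measure.rnDeriv_smul_left_of_ne_top a ρ (ENNReal.inv_ne_top.2 h0),
      Measure.rnDeriv_smul_left_of_ne_top b ρ (ENNReal.inv_ne_top.2 h0')] with z hz hz'
    rw [coe_geomMean, coe_geomMean, posterior, posterior, hz, hz']
    simp only [Pi.smul_apply, smul_eq_mul, ENNReal.toReal_mul, ENNReal.toReal_inv]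
    rw [Real.sqrt_mul (inv_nonneg.2 hZ.le), Real.sqrt_mul (inv_nonneg.2 hZ'.le), Real.sqrt_inv,
      Real.sqrt_inv]
    field_simp
  rw [haff, hellingerDistWrt_eq ρ _ _ hpaρ hpbρ] at hpost
  have hu := Real.sqrt_pos.2 hZ
  have hv := Real.sqrt_pos.2 hZ'
  have hu2 := Real.sq_sqrt hZ.le
  have hv2 := Real.sq_sqrt hZ'.le
  have hB0 : 0 ≤ B := integral_nonneg fun _ => NNReal.coe_nonneg _
  have hBuv : B ≤ √(evidence (pushUnnorm σ q e) μ).toReal *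
      √(evidence (pushUnnorm σ q e) μ').toReal := by
    rw [← div_le_one (mul_pos hu hv)]
    linarith [sq_nonneg (hellingerDist (posterior (pushUnnorm σ q e) μ)
      (posterior (pushUnnorm σ q e) μ'))]
  have halg := one_sub_div_mul_le hu hv hB0 hBuv
  rw [← hpost, hu2, hv2] at halg
  refine abs_le_of_sq_le_sq' ?_ (mul_nonneg (by positivity) (hellingerDist_nonneg _ _)) |>.2
  rw [mul_pow, mul_pow, Real.sq_sqrt (by positivity)]
  refine halg.trans ?_
  rw [div_le_iff₀ hZ]
  have : 2 ^ 2 * (C.toReal / (evidence (pushUnnorm σ q e) μ).toReal) * hellingerDist μ μ' ^ 2 *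
      (evidence (pushUnnorm σ q e) μ).toReal = 4 * C.toReal * hellingerDist μ μ' ^ 2 := by
    field_simp; ring
  rw [this]
  linarith

end Hellinger

theorem edist_le_bestLip_mul {Z : Type*} [MetricSpace Z] (f : Z → ℝ≥0) (z z' : Z) :
    edist (f z) (f z') ≤ bestLip f * edist z z' := by
  rcases eq_or_ne z z' with rfl | h
  · simp
  rw [← ENNReal.div_le_iff (edist_pos.2 h).ne' (edist_ne_top _ _)]
  exact le_iSup_of_le z (le_iSup_of_le z' (le_iSup_of_le h le_rfl))

theorem edist_mul_left_nnreal (a b c : ℝ≥0) : edist (a * b) (a * c) = a * edist b c := by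
  rw [edist_nndist, edist_nndist, NNReal.nndist_eq, NNReal.nndist_eq, ← mul_tsub, ← mul_tsub,
    ← mul_max, ENNReal.coe_mul]

/-! ### Lipschitz statements for any map of the common form. -/

section PushUnnorm

variable {Z S : Type*} [MeasurableSpace Z] [MeasurableSpace S] {σ : Measure S} [SigmaFinite σ]
  {q : Z × S → ℝ≥0} {e : Z × S → Z} {P : Set (Measure Z)} {G : Measure Z → Measure Z}

theorem posteriorLipschitz_tvDist_hellingerDist (hq : Measurable q) (he : Measurable e) {C : ℝ≥0∞}
    (hC : C ≠ ∞) (hqC : ∀ z, ∫⁻ s, q (z, s) ∂σ ≤ C) (hG : ∀ μ ∈ P, G μ = pushUnnorm σ q e μ)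
    (hP : ∀ μ ∈ P, IsProbabilityMeasure μ ∧ evidence G μ ≠ 0 ∧ evidence G μ ≠ ∞) :
    PosteriorLipschitz tvDist P G (fun μ => C.toReal / (evidence G μ).toReal) ∧
      PosteriorLipschitz hellingerDist P G (fun μ => 2 * √(C.toReal / (evidence G μ).toReal)) := by
  have hE : ∀ μ ∈ P, evidence G μ = evidence (pushUnnorm σ q e) μ := fun μ hμ => by
    rw [evidence, evidence, hG μ hμ]
  have hP' : ∀ μ ∈ P, evidence (pushUnnorm σ q e) μ ≠ 0 ∧ evidence (pushUnnorm σ q e) μ ≠ ∞ :=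
    fun μ hμ => hE μ hμ ▸ (hP μ hμ).2
  constructor
  · refine .congr (K := fun μ => C.toReal / (evidence (pushUnnorm σ q e) μ).toReal) hG
      (fun μ hμ => by rw [hE μ hμ]) (.of_le tvDist_nonneg hP' (fun μ hμ => by positivity) ?_)
    intro μ hμ μ' hμ'
    have := (hP μ hμ).1
    have := (hP μ' hμ').1
    exact tvDist_posterior_le hq he hC hqC μ μ' (hP' μ hμ).1 (hP' μ hμ).2 (hP' μ' hμ').1
      (hP' μ' hμ').2
  · refine .congr (K := fun μ => 2 * √(C.toReal / (evidence (pushUnnorm σ q e) μ).toReal)) hG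
      (fun μ hμ => by rw [hE μ hμ])
      (.of_le hellingerDist_nonneg hP' (fun μ hμ => by positivity) ?_)
    intro μ hμ μ' hμ'
    have := (hP μ hμ).1
    have := (hP μ' hμ').1
    exact hellingerDist_posterior_le hq he hC hqC μ μ' (hP' μ hμ).1 (hP' μ hμ).2 (hP' μ' hμ').1
      (hP' μ' hμ').2

theorem posteriorLipschitz_wasserstein1 [MetricSpace Z] [PolishSpace Z] [BorelSpace Z]
    (hq : Measurable q) (he : Measurable e) {B L : ℝ≥0∞}
    (hB : ∀ z z', ∫⁻ s, q (z, s) * edist (e (z, s)) (e (z', s)) ∂σ ≤ B * edist z z')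
    (hL : ∀ z z', ∫⁻ s, edist (q (z, s)) (q (z', s)) ∂σ ≤ L * edist z z')
    (hD : Metric.ediam (univ : Set Z) < ∞) (hBT : B ≠ ∞) (hLT : L ≠ ∞)
    (hG : ∀ μ ∈ P, G μ = pushUnnorm σ q e μ)
    (hP : ∀ μ ∈ P, IsProbabilityMeasure μ ∧ evidence G μ ≠ 0 ∧ evidence G μ ≠ ∞) :
    PosteriorLipschitz wasserstein1 (P ∩ wassersteinSpace1 Z) G fun μ =>
      (2 * (Metric.ediam (univ : Set Z)).toReal * L.toReal + B.toReal) /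
        (evidence G μ).toReal := by
  have hE : ∀ μ ∈ P, evidence G μ = evidence (pushUnnorm σ q e) μ := fun μ hμ => by
    rw [evidence, evidence, hG μ hμ]
  have hP' : ∀ μ ∈ P, evidence (pushUnnorm σ q e) μ ≠ 0 ∧ evidence (pushUnnorm σ q e) μ ≠ ∞ :=
    fun μ hμ => hE μ hμ ▸ (hP μ hμ).2
  have hT : 2 * Metric.ediam (univ : Set Z) * L ≠ ∞ :=
    ENNReal.mul_ne_top (ENNReal.mul_ne_top ENNReal.ofNat_ne_top hD.ne) hLT
  refine .congr (K := fun μ => (2 * Metric.ediam (univ : Set Z) * L + B).toReal /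
    (evidence (pushUnnorm σ q e) μ).toReal) (fun μ hμ => hG μ hμ.1) (fun μ hμ => ?_)
    (.of_le (fun _ _ => ENNReal.toReal_nonneg) (fun μ hμ => hP' μ hμ.1)
      (fun μ hμ => by positivity) ?_)
  · rw [hE μ hμ.1, ENNReal.toReal_add hT hBT, ENNReal.toReal_mul, ENNReal.toReal_mul,
      ENNReal.toReal_ofNat]
  · intro μ hμ μ' hμ'
    have := (hP μ hμ.1).1
    have := (hP μ' hμ'.1).1
    refine wasserstein1_posterior_le hq he hB hL hD ?_ (ENNReal.add_ne_top.2 ⟨hT, hBT⟩)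
      (hP' μ hμ.1).1 (hP' μ hμ.1).2 (hP' μ' hμ'.1).1 (hP' μ' hμ'.1).2
    -- The transport argument gives `B + DL`; the constant `2DL + B` is larger.
    rw [add_comm, two_mul, add_mul]
    gcongr
    exact le_self_add

end PushUnnorm

/-! ### The three problems in the common form. -/

theorem ipUnnorm_eq_pushUnnorm {X Y : Type*} [MeasurableSpace X] {h : Y → X → ℝ≥0} {y : Y}
    (hh : Measurable (h y)) (μ : Measure X) [SFinite μ] :
    ipUnnorm h y μ =
      pushUnnorm (Measure.dirac ()) (fun p : X × Unit => h y p.1) Prod.fst μ := by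
  ext A hA
  rw [pushUnnorm_apply (by fun_prop) measurable_fst μ hA, ipUnnorm, withDensity_apply _ hA,
    ← lintegral_indicator hA]
  refine lintegral_congr fun x => ?_
  by_cases hx : x ∈ A <;> simp [hx]

theorem seUnnorm_eq_pushUnnorm {X Y : Type*} [MeasurableSpace X] (vX : Measure X) [SigmaFinite vX]
    {h : Y → X → ℝ≥0} {T : X → X → ℝ≥0} {y : Y} (hh : Measurable (h y))
    (hT : Measurable fun q : X × X => T q.1 q.2) (μ : Measure X) [SFinite μ] :
    seUnnorm vX h T y μ =
      pushUnnorm vX (fun p : X × X => h y p.2 * T p.2 p.1) Prod.snd μ := by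
  have hT' : Measurable fun p : X × X => T p.2 p.1 := hT.comp measurable_swap
  ext A hA
  have mA : Measurable (A.indicator (1 : X → ℝ≥0∞)) := measurable_one.indicator hA
  rw [pushUnnorm_apply (by fun_prop) measurable_snd μ hA, seUnnorm, withDensity_apply _ hA,
    ← lintegral_indicator hA, lintegral_lintegral_swap (by fun_prop)]
  refine lintegral_congr fun x => ?_
  by_cases hx : x ∈ A
  · have : Measurable fun x' => T x x' := hT.comp measurable_prodMk_left
    simp only [hx, indicator_of_mem, Pi.one_apply, mul_one, ENNReal.coe_mul]
    rw [lintegral_const_mul _ (by fun_prop)]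
  · simp [hx]

section ParameterState

variable {X W Y : Type*} [MeasurableSpace X] [MeasurableSpace W] (vX : Measure X) [SigmaFinite vX]
  (vW : Measure W) [SigmaFinite vW] {h : Y → X → W → ℝ≥0} {T : X → X → W → ℝ≥0} {y : Y}

/-- Tonelli in the previous state `x'` and the current state `x` at fixed `w`. The right side
depends on `π` only through the measure it defines, so every version of the density gives the same
result. -/
theorem withDensity_psDensity_eq_pushUnnorm (hh : Measurable fun p : X × W => h y p.1 p.2)
    (hT : Measurable fun q : X × X × W => T q.1 q.2.1 q.2.2) {π : X × W → ℝ≥0∞}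
    (hπ : Measurable π) :
    (vX.prod vW).withDensity (psDensity vX h T y π) =
      pushUnnorm vX (fun p : (X × W) × X => h y p.2 p.1.2 * T p.2 p.1.1 p.1.2)
        (fun p => (p.2, p.1.2)) ((vX.prod vW).withDensity π) := by
  have mh : Measurable fun p : (X × W) × X => h y p.2 p.1.2 :=
    hh.comp (measurable_snd.prodMk (measurable_snd.comp measurable_fst))
  have mT : Measurable fun p : (X × W) × X => T p.2 p.1.1 p.1.2 :=
    hT.comp (measurable_snd.prodMk measurable_fst)
  have mTπ : Measurable fun p : (X × W) × X => (T p.1.1 p.2 p.1.2 * π (p.2, p.1.2) : ℝ≥0∞) :=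
    (Measurable.coe_nnreal_ennreal (hT.comp (g := fun q : X × X × W => T q.1 q.2.1 q.2.2)
      (f := fun p : (X × W) × X => (p.1.1, p.2, p.1.2)) (by fun_prop))).mul
      (hπ.comp (by fun_prop))
  have md : Measurable (psDensity vX h T y π) :=
    hh.coe_nnreal_ennreal.mul (Measurable.lintegral_prod_right' mTπ)
  ext A hA
  have mA : Measurable (A.indicator (1 : X × W → ℝ≥0∞)) := measurable_one.indicator hA
  have mq : Measurable fun p : (X × W) × X =>
      (↑(h y p.2 p.1.2 * T p.2 p.1.1 p.1.2) * A.indicator 1 (p.2, p.1.2) : ℝ≥0∞) := by fun_prop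
  have mI : Measurable fun p : X × W => ∫⁻ s,
      (↑(h y s p.2 * T s p.1 p.2) * A.indicator 1 (s, p.2) : ℝ≥0∞) ∂vX :=
    mq.lintegral_prod_right'
  rw [pushUnnorm_apply (by fun_prop) (by fun_prop) _ hA, withDensity_apply _ hA,
    ← lintegral_indicator hA, lintegral_withDensity_eq_lintegral_mul _ hπ mI,
    lintegral_prod_symm' _ (md.indicator hA), lintegral_prod_symm' _ (hπ.mul mI)]
  refine lintegral_congr fun w => ?_
  have mqw : Measurable fun p : X × X =>
      (π (p.1, w) * (↑(h y p.2 w * T p.2 p.1 w) * A.indicator 1 (p.2, w)) : ℝ≥0∞) :=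
    (hπ.comp (by fun_prop)).mul (mq.comp (f := fun p : X × X => ((p.1, w), p.2)) (by fun_prop))
  have e1 : ∀ x', (π * fun p : X × W => ∫⁻ s,
      (↑(h y s p.2 * T s p.1 p.2) * A.indicator 1 (s, p.2) : ℝ≥0∞) ∂vX) (x', w) =
      ∫⁻ s, π (x', w) * (↑(h y s w * T s x' w) * A.indicator 1 (s, w)) ∂vX := fun x' => by
    have mqx : Measurable fun s : X =>
        (↑(h y s w * T s x' w) * A.indicator 1 (s, w) : ℝ≥0∞) :=
      mq.comp (f := fun s : X => ((x', w), s)) (by fun_prop)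
    rw [Pi.mul_apply, lintegral_const_mul _ mqx]
  simp only [e1]
  rw [lintegral_lintegral_swap mqw.aemeasurable]
  refine lintegral_congr fun x => ?_
  by_cases hx : (x, w) ∈ A
  · simp only [hx, indicator_of_mem, Pi.one_apply, mul_one, ENNReal.coe_mul, psDensity]
    have mTx : Measurable fun x' : X => (T x x' w * π (x', w) : ℝ≥0∞) :=
      mTπ.comp (f := fun x' : X => ((x, w), x')) (by fun_prop)
    rw [← lintegral_const_mul _ mTx]
    refine lintegral_congr fun x' => ?_
    ring
  · simp [hx]

theorem psUnnorm_eq_pushUnnorm (hh : Measurable fun p : X × W => h y p.1 p.2)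
    (hT : Measurable fun q : X × X × W => T q.1 q.2.1 q.2.2) {μ : Measure (X × W)} [SigmaFinite μ]
    (hμ : μ ≪ vX.prod vW) :
    psUnnorm vX vW h T y μ =
      pushUnnorm vX (fun p : (X × W) × X => h y p.2 p.1.2 * T p.2 p.1.1 p.1.2)
        (fun p => (p.2, p.1.2)) μ := by
  rw [psUnnorm, withDensity_psDensity_eq_pushUnnorm vX vW hh hT (Measure.measurable_rnDeriv _ _),
    Measure.withDensity_rnDeriv_eq _ _ hμ]

/-- Admissibility is phrased with some version `π`, the map with `rnDeriv`; this identifies the two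
evidences. -/
theorem psUnnorm_univ (hh : Measurable fun p : X × W => h y p.1 p.2)
    (hT : Measurable fun q : X × X × W => T q.1 q.2.1 q.2.2) {μ : Measure (X × W)} [SigmaFinite μ]
    {π : X × W → ℝ≥0∞} (hπ : Measurable π) (hμ : μ = (vX.prod vW).withDensity π) :
    psUnnorm vX vW h T y μ univ = ∫⁻ p, psDensity vX h T y π p ∂(vX.prod vW) := by
  rw [psUnnorm_eq_pushUnnorm vX vW hh hT (hμ ▸ withDensity_absolutelyContinuous _ _), hμ,
    ← withDensity_psDensity_eq_pushUnnorm vX vW hh hT hπ, withDensity_apply _ MeasurableSet.univ,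
    Measure.restrict_univ]

end ParameterState

/-! ### Verification of the constants in each problem. -/

theorem inverseProblem_posteriorLipschitz {X Y : Type*} [MetricSpace X] [PolishSpace X]
    [MeasurableSpace X] [BorelSpace X] (h : Y → X → ℝ≥0) (y : Y) (hh : Measurable (h y))
    (hC : ipC h y < ∞) :
    PosteriorLipschitz tvDist (ipAdmissible h y) (ipUnnorm h y)
        (fun μ => (ipC h y).toReal / (evidence (ipUnnorm h y) μ).toReal) ∧
      PosteriorLipschitz hellingerDist (ipAdmissible h y) (ipUnnorm h y)
        (fun μ => 2 * √((ipC h y).toReal / (evidence (ipUnnorm h y) μ).toReal)) ∧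
      (bestLip (h y) < ∞ → Metric.ediam (univ : Set X) < ∞ →
        PosteriorLipschitz wasserstein1 (ipAdmissible h y ∩ wassersteinSpace1 X) (ipUnnorm h y)
          (fun μ => (2 * (Metric.ediam (univ : Set X)).toReal * (bestLip (h y)).toReal
            + (ipC h y).toReal) / (evidence (ipUnnorm h y) μ).toReal)) := by
  have hle : ∀ x, (h y x : ℝ≥0∞) ≤ ipC h y := fun x => le_iSup (fun x => (h y x : ℝ≥0∞)) x
  have mq : Measurable fun p : X × Unit => h y p.1 := by fun_prop
  have hG : ∀ μ ∈ ipAdmissible h y, ipUnnorm h y μ =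
      pushUnnorm (Measure.dirac ()) (fun p : X × Unit => h y p.1) Prod.fst μ := fun μ hμ => by
    have := hμ.1
    exact ipUnnorm_eq_pushUnnorm hh μ
  have hP : ∀ μ ∈ ipAdmissible h y, IsProbabilityMeasure μ ∧ evidence (ipUnnorm h y) μ ≠ 0 ∧
      evidence (ipUnnorm h y) μ ≠ ∞ := fun μ hμ => by
    rw [evidence, ipUnnorm, withDensity_apply _ MeasurableSet.univ, Measure.restrict_univ]
    exact ⟨hμ.1, hμ.2.1.ne', hμ.2.2.ne⟩
  obtain ⟨h1, h2⟩ := posteriorLipschitz_tvDist_hellingerDist mq measurable_fst hC.ne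
    (fun z => by simpa using hle z) hG hP
  refine ⟨h1, h2, fun hL hD => ?_⟩
  refine posteriorLipschitz_wasserstein1 mq measurable_fst (fun z z' => ?_) (fun z z' => ?_) hD
    hC.ne hL.ne hG hP
  · rw [lintegral_dirac]
    gcongr
    exact hle z
  · rw [lintegral_dirac]
    exact edist_le_bestLip_mul _ _ _

theorem stateEstimation_posteriorLipschitz {X Y : Type*} [MetricSpace X] [PolishSpace X]
    [MeasurableSpace X] [BorelSpace X] (vX : Measure X) [SigmaFinite vX] (h : Y → X → ℝ≥0)
    (T : X → X → ℝ≥0) (y : Y) (hh : Measurable (h y))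
    (hT : Measurable (fun q : X × X => T q.1 q.2)) :
    (seC vX h T y < ∞ →
      PosteriorLipschitz tvDist (seAdmissible vX h T y) (seUnnorm vX h T y)
        (fun μ => (seC vX h T y).toReal / (evidence (seUnnorm vX h T y) μ).toReal) ∧
      PosteriorLipschitz hellingerDist (seAdmissible vX h T y) (seUnnorm vX h T y)
        (fun μ => 2 * √((seC vX h T y).toReal / (evidence (seUnnorm vX h T y) μ).toReal))) ∧
    ((∀ x, bestLip (T x) < ∞) → seCstar vX h T y < ∞ → Metric.ediam (univ : Set X) < ∞ →
      PosteriorLipschitz wasserstein1 (seAdmissible vX h T y ∩ wassersteinSpace1 X)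
        (seUnnorm vX h T y)
        (fun μ => 2 * (Metric.ediam (univ : Set X)).toReal * (seCstar vX h T y).toReal
          / (evidence (seUnnorm vX h T y) μ).toReal)) := by
  have hT' : Measurable fun p : X × X => T p.2 p.1 := hT.comp measurable_swap
  have mq : Measurable fun p : X × X => h y p.2 * T p.2 p.1 := by fun_prop
  have hG : ∀ μ ∈ seAdmissible vX h T y, seUnnorm vX h T y μ =
      pushUnnorm vX (fun p : X × X => h y p.2 * T p.2 p.1) Prod.snd μ := fun μ hμ => by
    have := hμ.1
    exact seUnnorm_eq_pushUnnorm vX hh hT μ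
  have hP : ∀ μ ∈ seAdmissible vX h T y, IsProbabilityMeasure μ ∧
      evidence (seUnnorm vX h T y) μ ≠ 0 ∧ evidence (seUnnorm vX h T y) μ ≠ ∞ := fun μ hμ => by
    rw [evidence, seUnnorm, withDensity_apply _ MeasurableSet.univ, Measure.restrict_univ]
    exact ⟨hμ.1, hμ.2.2.1.ne', hμ.2.2.2.ne⟩
  refine ⟨fun hC => posteriorLipschitz_tvDist_hellingerDist mq measurable_snd hC.ne
    (fun z => ?_) hG hP, fun _ hC hD => ?_⟩
  · simp only [ENNReal.coe_mul]
    exact le_iSup (fun x' => ∫⁻ x, (h y x : ℝ≥0∞) * T x x' ∂vX) z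
  · have := posteriorLipschitz_wasserstein1 (B := 0) mq measurable_snd (fun z z' => by simp)
      (fun z z' => ?_) hD ENNReal.zero_ne_top hC.ne hG hP
    · simpa using this
    · rw [seCstar, ← lintegral_mul_const' _ _ (edist_ne_top _ _)]
      refine lintegral_mono fun x => ?_
      rw [edist_mul_left_nnreal, mul_assoc]
      gcongr
      exact edist_le_bestLip_mul _ _ _

theorem parameterState_posteriorLipschitz {X W Y : Type*} [MeasurableSpace X] [MeasurableSpace W]
    [MetricSpace (X × W)] [PolishSpace (X × W)] [BorelSpace (X × W)]
    (vX : Measure X) [SigmaFinite vX] (vW : Measure W) [SigmaFinite vW]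
    (h : Y → X → W → ℝ≥0) (T : X → X → W → ℝ≥0) (y : Y)
    (hh : Measurable (fun p : X × W => h y p.1 p.2))
    (hT : Measurable (fun q : X × X × W => T q.1 q.2.1 q.2.2)) (hC : psC vX h T y < ∞) :
    PosteriorLipschitz tvDist (psAdmissible vX vW h T y) (psUnnorm vX vW h T y)
      (fun μ => (psC vX h T y).toReal / (evidence (psUnnorm vX vW h T y) μ).toReal) ∧
    PosteriorLipschitz hellingerDist (psAdmissible vX vW h T y) (psUnnorm vX vW h T y)
      (fun μ => 2 * √((psC vX h T y).toReal / (evidence (psUnnorm vX vW h T y) μ).toReal)) ∧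
    ((∀ x, psLip h T y x < ∞) → psCstar vX h T y < ∞ →
      (∀ (x x₁ x₂ : X) (w w' : W), dist (x, w) (x, w') ≤ dist (x₁, w) (x₂, w')) →
      Metric.ediam (univ : Set (X × W)) < ∞ →
      PosteriorLipschitz wasserstein1 (psAdmissible vX vW h T y ∩ wassersteinSpace1 (X × W))
        (psUnnorm vX vW h T y)
        (fun μ => (2 * (Metric.ediam (univ : Set (X × W))).toReal * (psCstar vX h T y).toReal
          + (psC vX h T y).toReal) / (evidence (psUnnorm vX vW h T y) μ).toReal)) := by
  have mh : Measurable fun p : (X × W) × X => h y p.2 p.1.2 :=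
    hh.comp (measurable_snd.prodMk (measurable_snd.comp measurable_fst))
  have mT : Measurable fun p : (X × W) × X => T p.2 p.1.1 p.1.2 :=
    hT.comp (measurable_snd.prodMk measurable_fst)
  have mq : Measurable fun p : (X × W) × X => h y p.2 p.1.2 * T p.2 p.1.1 p.1.2 := mh.mul mT
  have me : Measurable fun p : (X × W) × X => (p.2, p.1.2) := by fun_prop
  have hqC : ∀ z : X × W, ∫⁻ x, (↑(h y x z.2 * T x z.1 z.2) : ℝ≥0∞) ∂vX ≤ psC vX h T y :=
    fun z => by
      simp only [ENNReal.coe_mul]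
      exact le_iSup₂ (f := fun x' w => ∫⁻ x, (h y x w : ℝ≥0∞) * T x x' w ∂vX) z.1 z.2
  have hG : ∀ μ ∈ psAdmissible vX vW h T y, psUnnorm vX vW h T y μ =
      pushUnnorm vX (fun p : (X × W) × X => h y p.2 p.1.2 * T p.2 p.1.1 p.1.2)
        (fun p => (p.2, p.1.2)) μ := fun μ ⟨_, π, _, hμ, _⟩ =>
    psUnnorm_eq_pushUnnorm vX vW hh hT (hμ ▸ withDensity_absolutelyContinuous _ _)
  have hP : ∀ μ ∈ psAdmissible vX vW h T y, IsProbabilityMeasure μ ∧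
      evidence (psUnnorm vX vW h T y) μ ≠ 0 ∧ evidence (psUnnorm vX vW h T y) μ ≠ ∞ :=
    fun μ ⟨hpr, π, hπ, hμ, _, h0, h1⟩ => by
      rw [evidence, psUnnorm_univ vX vW hh hT hπ hμ]
      exact ⟨hpr, h0.ne', h1.ne⟩
  obtain ⟨h1, h2⟩ := posteriorLipschitz_tvDist_hellingerDist mq me hC.ne hqC hG hP
  refine ⟨h1, h2, fun _ hL hd hD => posteriorLipschitz_wasserstein1 mq me (fun z z' => ?_)
    (fun z z' => ?_) hD hC.ne hL.ne hG hP⟩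
  · refine le_trans (lintegral_mono fun x => ?_) ((lintegral_mul_const' (edist z z') _
      (edist_ne_top _ _)).trans_le (by gcongr; exact hqC z))
    gcongr
    rw [edist_dist, edist_dist]
    exact ENNReal.ofReal_le_ofReal (hd x z.1 z'.1 z.2 z'.2)
  · rw [psCstar, ← lintegral_mul_const' _ _ (edist_ne_top _ _)]
    exact lintegral_mono fun x =>
      edist_le_bestLip_mul (fun p : X × W => h y x p.2 * T x p.1 p.2) z z'

end BayesLip

theorem mainTheorem1 :
    -- inverse problems
    (∀ (X : Type*) (Y : Type*) [MetricSpace X] [PolishSpace X] [MeasurableSpace X] [BorelSpace X]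
        (h : Y → X → ℝ≥0) (y : Y), Measurable (h y) → ipC h y < ∞ →
      PosteriorLipschitz tvDist (ipAdmissible h y) (ipUnnorm h y)
        (fun μ => (ipC h y).toReal / (evidence (ipUnnorm h y) μ).toReal) ∧
      PosteriorLipschitz hellingerDist (ipAdmissible h y) (ipUnnorm h y)
        (fun μ => 2 * √((ipC h y).toReal / (evidence (ipUnnorm h y) μ).toReal)) ∧
      (bestLip (h y) < ∞ → Metric.ediam (univ : Set X) < ∞ →
        PosteriorLipschitz wasserstein1 (ipAdmissible h y ∩ wassersteinSpace1 X) (ipUnnorm h y)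
          (fun μ => (2 * (Metric.ediam (univ : Set X)).toReal * (bestLip (h y)).toReal
            + (ipC h y).toReal) / (evidence (ipUnnorm h y) μ).toReal))) ∧
    -- state estimation
    (∀ (X : Type*) (Y : Type*) [MetricSpace X] [PolishSpace X] [MeasurableSpace X] [BorelSpace X]
        (vX : Measure X) [SigmaFinite vX] (h : Y → X → ℝ≥0) (T : X → X → ℝ≥0) (y : Y),
        Measurable (h y) → Measurable (fun q : X × X => T q.1 q.2) →
      (seC vX h T y < ∞ →
        PosteriorLipschitz tvDist (seAdmissible vX h T y) (seUnnorm vX h T y)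
          (fun μ => (seC vX h T y).toReal / (evidence (seUnnorm vX h T y) μ).toReal) ∧
        PosteriorLipschitz hellingerDist (seAdmissible vX h T y) (seUnnorm vX h T y)
          (fun μ => 2 * √((seC vX h T y).toReal / (evidence (seUnnorm vX h T y) μ).toReal))) ∧
      ((∀ x, bestLip (T x) < ∞) → seCstar vX h T y < ∞ → Metric.ediam (univ : Set X) < ∞ →
        PosteriorLipschitz wasserstein1 (seAdmissible vX h T y ∩ wassersteinSpace1 X)
          (seUnnorm vX h T y)
          (fun μ => 2 * (Metric.ediam (univ : Set X)).toReal * (seCstar vX h T y).toReal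
            / (evidence (seUnnorm vX h T y) μ).toReal))) ∧
    -- parameter-state estimation
    (∀ (X : Type*) (W : Type*) (Y : Type*) [MeasurableSpace X] [MeasurableSpace W]
        [MetricSpace (X × W)] [PolishSpace (X × W)] [BorelSpace (X × W)]
        (vX : Measure X) [SigmaFinite vX] (vW : Measure W) [SigmaFinite vW]
        (h : Y → X → W → ℝ≥0) (T : X → X → W → ℝ≥0) (y : Y),
        Measurable (fun p : X × W => h y p.1 p.2) →
        Measurable (fun q : X × X × W => T q.1 q.2.1 q.2.2) → psC vX h T y < ∞ →
      PosteriorLipschitz tvDist (psAdmissible vX vW h T y) (psUnnorm vX vW h T y)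
        (fun μ => (psC vX h T y).toReal / (evidence (psUnnorm vX vW h T y) μ).toReal) ∧
      PosteriorLipschitz hellingerDist (psAdmissible vX vW h T y) (psUnnorm vX vW h T y)
        (fun μ => 2 * √((psC vX h T y).toReal / (evidence (psUnnorm vX vW h T y) μ).toReal)) ∧
      ((∀ x, psLip h T y x < ∞) → psCstar vX h T y < ∞ →
        (∀ (x x₁ x₂ : X) (w w' : W), dist (x, w) (x, w') ≤ dist (x₁, w) (x₂, w')) →
        Metric.ediam (univ : Set (X × W)) < ∞ →
        PosteriorLipschitz wasserstein1 (psAdmissible vX vW h T y ∩ wassersteinSpace1 (X × W))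
          (psUnnorm vX vW h T y)
          (fun μ => (2 * (Metric.ediam (univ : Set (X × W))).toReal * (psCstar vX h T y).toReal
            + (psC vX h T y).toReal) / (evidence (psUnnorm vX vW h T y) μ).toReal))) := by
  exact ⟨fun _ _ _ _ _ _ h y => inverseProblem_posteriorLipschitz h y,
    fun _ _ _ _ _ _ vX _ h T y => stateEstimation_posteriorLipschitz vX h T y,
    fun _ _ _ _ _ _ _ _ vX _ vW _ h T y => parameterState_posteriorLipschitz vX vW h T y⟩
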